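/- **Formal Fatou coordinate of a parabolic Dulac germ.** *Transseries.* Put $\boldsymbol\ell_0=x$, $\boldsymbol\ell=\boldsymbol\ell_1=-1/\log x$ and $\boldsymbol\ell_{k+1}=-1/\log\boldsymbol\ell_k$. For $j\ge 0$ let $\widehat{\mathcal L}_j^\infty$ be the set of formal sums $\sum a_\gamma\, x^{\gamma_0}\boldsymbol\ell_1^{\gamma_1}\cdots\boldsymbol\ell_j^{\gamma_j}$ with $a_\gamma\in\mathbb R$, $\gamma\in\mathbb R^{j+1}$, such that for every $k\le j$ and every choice of $\gamma_0,\dots,\gamma_{k-1}$ the exponents $\gamma_k$ occurring together with them form a finite sequence, or a strictly increasing one tending to $+\infty$. Let $\widehat{\mathfrak L}=\bigcup_j\widehat{\mathcal L}_j^\infty$, and let $\widehat{\mathcal L}^\infty\subset\widehat{\mathcal L}_1^\infty$ be the subset of transseries with only integer powers of $\boldsymbol\ell$. A sequence of reals is called *finitely generated* here if its terms are linear combinations, with coefficients in $\mathbb N_0$, of finitely many strictly positive real numbers. *Dulac germs.* A germ at $0^+$ of a real function $f$, analytic on some $(0,\varepsilon)$, is a *Dulac germ* with expansion $\widehat f=\sum_{i\ge1}P_i(\boldsymbol\ell)x^{\beta_i}$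 if $(\beta_i)$ is a strictly increasing, finitely generated sequence of positive reals, the $P_i$ are finite real linear combinations of integer powers (possibly zero), $f-\sum_{i\le n}P_i(\boldsymbol\ell)x^{\beta_i}=o(x^{\beta_n})$ as $x\to0^+$ for every $n$, and $f$ extends, in the logarithmic chart $\zeta=-\log x$, to an analytic function on a standard quadratic domain, i.e. the image of $\{\operatorname{Re}w>0,\ |w|>r\}$ under $w\mapsto w+C(w+1)^{1/2}$ with $C>0$, with the same asymptotic expansion there as $\operatorname{Re}\zeta\to+\infty$. It is *parabolic* if $\beta_1=1$, $P_1=1$ and $P_i\ne0$ for some $i>1$. A *formal Fatou coordinate* of $f$ is a $\widehat\Psi\in\widehat{\mathfrak L}$ with $\widehat\Psi(\widehat f)-\widehat\Psi=1$ formally. **Proposition.** Let $f$ be a parabolic Dulac germ with expansion $\widehat f$. A formal Fatou coordinate $\widehat\Psi\in\widehat{\mathfrak L}$ of $f$ exists, it is unique up to an additive real constant, and it belongs to $\widehat{\mathcal L}_2^\infty$. For every such $\widehat\Psi$ there is $\rho\in\mathbb R$ such that $\widehat\Psi-\rho\,\boldsymbol\ell_2^{-1}\in\widehat{\mathcal L}^\infty$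 and $$\widehat\Psi-\rho\,\boldsymbol\ell_2^{-1}=\sum_{i=1}^\infty x^{\alpha_i}\widehat f_i(\boldsymbol\ell),$$ where 1. $\alpha_1<0$ and $\widehat f_1\neq0$; 2. $(\alpha_i)_{i\ge 1}$ is a strictly increasing real sequence tending to $+\infty$, and $(\alpha_i-\alpha_1)_{i\ge1}$ is finitely generated; 3. each $\widehat f_i$ (possibly zero for $i>1$) is a formal Laurent series with real coefficients of the form $$\widehat f_i(\boldsymbol\ell)=\frac{\int x^{\alpha_i-1}\widehat R_i(\boldsymbol\ell)\,dx}{x^{\alpha_i}},$$ that is, $x^{\alpha_i}\widehat f_i(\boldsymbol\ell)$ is a formal antiderivative in $\widehat{\mathfrak L}$ of $x^{\alpha_i-1}\widehat R_i(\boldsymbol\ell)$, where $\widehat R_i$ is the Laurent expansion at $0$ of a real rational function. In particular, the only monomial of $\widehat\Psi$ in which an iterated logarithm $\boldsymbol\ell_k$, $k\ge2$, occurs is (if $\rho\ne0$) $\rho\,\boldsymbol\ell_2^{-1}$. -/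

import Mathlib

open scoped Topology

noncomputable section

namespace Dulac

/-- Exponents `(γ₀, γ₁, γ₂, …)` (finitely many nonzero) of the monomials
`x ^ γ₀ * ℓ₁ ^ γ₁ * ℓ₂ ^ γ₂ * ⋯`, ordered lexicographically. Here `ℓ₀ = x`, `ℓ₁ = ℓ = -1 / log x` and
`ℓ_{k+1} = ℓ ∘ ℓ_k = -1 / log ℓ_k`. -/
abbrev Expo : Type := Lex (ℕ →₀ ℝ)

/-- Real transseries in `x` and the iterated logarithms `ℓ₁, ℓ₂, …`, with well-ordered support. -/
abbrev Transseries : Type := HahnSeries Expo ℝ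

/-- The exponent of the monomial `ℓ_k ^ a` (`x ^ a` for `k = 0`). -/
def expo (k : ℕ) (a : ℝ) : Expo := toLex (Finsupp.single k a)

/-- The monomial `ℓ_k ^ a` (`x ^ a` for `k = 0`). -/
def ellPow (k : ℕ) (a : ℝ) : Transseries := HahnSeries.single (expo k a) 1

/-- The transseries `g` is the formal sum of the family `s`: the family is summable in the usual
sense of generalized power series (the union of the supports is well-ordered and every monomial
occurs in only finitely many members), and `g` is obtained by adding coefficients. -/
def IsFormalSum {ι : Type*} (s : ι → Transseries) (g : Transseries) : Prop :=
  ∃ S : HahnSeries.SummableFamily Expo ℝ ι, (∀ i, S i = s i) ∧ S.hsum = g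

/-- The class `𝓛_j^∞`: only `ℓ₀ = x, ℓ₁, …, ℓ_j` occur and, for every `k ≤ j` and every choice of
the exponents of `ℓ₀, …, ℓ_{k-1}`, the exponents of `ℓ_k` that occur together with them form a
finite, or a strictly increasing infinite, sequence tending to `+∞`; that is, only finitely many of
them lie below any given bound. -/
def InClass (j : ℕ) (g : Transseries) : Prop :=
  (∀ γ ∈ g.support, ∀ k, j < k → ofLex γ k = 0) ∧
  ∀ k ≤ j, ∀ (p : ℕ → ℝ) (c : ℝ),
    {t : ℝ | t ≤ c ∧ ∃ γ ∈ g.support, (∀ i < k, ofLex γ i = p i) ∧ ofLex γ k = t}.Finite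

/-- The class `𝔏 = ⋃_j 𝓛_j^∞` of power-iterated logarithm transseries. -/
def InFrakL (g : Transseries) : Prop := ∃ j, InClass j g

/-- The class `𝓛^∞ ⊆ 𝓛_1^∞` of transseries in `x` and `ℓ` with integer powers of `ℓ`. -/
def InLInfty (g : Transseries) : Prop :=
  InClass 1 g ∧ ∀ γ ∈ g.support, ∃ n : ℤ, ofLex γ 1 = n

/-! ### Composition with a parabolic transseries -/

/-- `u ^ a` for a transseries `u = 1 + (infinitesimal)` and a real exponent, by the binomial
series. -/
def realPow (u : Transseries) (a : ℝ) : Transseries :=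
  PowerSeries.heval (u - 1) (PowerSeries.binomialSeries ℝ a)

/-- `log u` for a transseries `u = 1 + (infinitesimal)`. -/
def formalLog (u : Transseries) : Transseries :=
  PowerSeries.heval (u - 1) (PowerSeries.log ℝ)

/-- For parabolic `f`, the transseries `u_k` with `ℓ_k ∘ f = ℓ_k * u_k`: one has `u_0 = f / x` and,
since `ℓ_{k+1} ∘ f = -1 / log (ℓ_k * u_k) = -1 / (-1 / ℓ_{k+1} + log u_k)`,
`u_{k+1} = 1 / (1 - ℓ_{k+1} * log u_k)`. -/
def ellFactor (f : Transseries) : ℕ → Transseries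
  | 0 => ellPow 0 (-1) * f
  | k + 1 => (1 - ellPow (k + 1) 1 * formalLog (ellFactor f k))⁻¹

/-- The monomial with exponent `γ` composed with the parabolic transseries `f`:
`∏ (ℓ_k ∘ f) ^ γ_k = ∏ ℓ_k ^ γ_k * ∏ u_k ^ γ_k`. -/
def monoComp (f : Transseries) (γ : Expo) : Transseries :=
  HahnSeries.single γ 1 * ∏ k ∈ (ofLex γ).support, realPow (ellFactor f k) (ofLex γ k)

/-- `h = g ∘ f` for a parabolic transseries `f`, monomial by monomial. -/
def IsComp (g f h : Transseries) : Prop :=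
  IsFormalSum (fun γ : Expo => HahnSeries.C (g.coeff γ) * monoComp f γ) h

/-- `Ψ ∈ 𝔏` is a formal Fatou coordinate of the parabolic transseries `f`: it satisfies the Abel
equation `Ψ ∘ f - Ψ = 1`. -/
def IsFormalFatou (f Ψ : Transseries) : Prop :=
  InFrakL Ψ ∧ IsComp Ψ f (Ψ + 1)

/-! ### Formal differentiation -/

/-- The exponent of the logarithmic derivative `ℓ_k' / ℓ_k = x⁻¹ * ℓ₁ * ⋯ * ℓ_k`. -/
def logDerivExpo (k : ℕ) : Expo :=
  expo 0 (-1) + ∑ i ∈ Finset.Icc 1 k, expo i 1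

/-- The derivative with respect to `x` of the monomial with exponent `γ`. -/
def monoDeriv (γ : Expo) : Transseries :=
  ∑ k ∈ (ofLex γ).support, HahnSeries.single (γ + logDerivExpo k) (ofLex γ k)

/-- `G` is a formal antiderivative of `g` in `𝔏`: differentiating `G ∈ 𝔏` monomial by monomial
gives `g`. -/
def IsFormalAntideriv (G g : Transseries) : Prop :=
  InFrakL G ∧ IsFormalSum (fun γ : Expo => HahnSeries.C (G.coeff γ) * monoDeriv γ) g

/-! ### Blocks -/

/-- The order embedding `n ↦` exponent of `ℓ ^ n`. -/
def ellExpo : ℤ ↪o Expo :=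
  OrderEmbedding.ofStrictMono (fun n : ℤ => expo 1 (n : ℝ)) (by
    intro m n h
    rw [Finsupp.Lex.lt_iff]
    refine ⟨1, fun i hi => ?_, ?_⟩
    · have : i ≠ 1 := hi.ne
      simp [expo, this]
    · simpa [expo] using h)

/-- The block `x ^ a * F(ℓ)`, for a formal Laurent series `F`. -/
def block (a : ℝ) (F : LaurentSeries ℝ) : Transseries :=
  ellPow 0 a * HahnSeries.embDomain ellExpo F

/-- The block `x ^ a * P(ℓ)`, for a finite sum `P` of integer powers. -/
def polyBlock (a : ℝ) (P : LaurentPolynomial ℝ) : Transseries :=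
  ∑ n ∈ P.coeff.support, HahnSeries.C (P.coeff n) * (ellPow 0 a * ellPow 1 (n : ℝ))

/-! ### Dulac germs -/

/-- The real numbers `s i` all lie in a sub-semigroup with zero of `(ℝ, +)` generated by finitely
many strictly positive numbers. -/
def FinitelyGenerated (s : ℕ → ℝ) : Prop :=
  ∃ B : Finset ℝ, (∀ b ∈ B, 0 < b) ∧ ∀ i, s i ∈ AddSubmonoid.closure (B : Set ℝ)

/-- An (infinite) increasing sequence of finite type; finite sequences are continued by exponents
with zero coefficients. -/
def IsFiniteType (α : ℕ → ℝ) : Prop :=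
  (∀ i, 0 < α i) ∧ StrictMono α ∧ FinitelyGenerated α

/-- The value at `y` of a finite sum of integer powers. -/
def evalLaurent {K : Type*} [Field K] [Algebra ℝ K] (P : LaurentPolynomial ℝ) (y : K) : K :=
  P.coeff.sum fun n a => algebraMap ℝ K a * y ^ n

/-- A standard quadratic domain in the logarithmic chart `ζ = -log z`: the image of
`{w | Re w > 0, |w| > r}` under `w ↦ w + C * (w + 1) ^ (1 / 2)`. -/
def quadraticDomain (C r : ℝ) : Set ℂ :=
  (fun w : ℂ => w + (C : ℂ) * (w + 1) ^ (1 / 2 : ℂ)) '' {w : ℂ | 0 < w.re ∧ r < ‖w‖}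

/-- The function `f`, considered as a germ at `0⁺`, is a Dulac germ whose expansion is
`∑ i, P i (ℓ) * x ^ α i`. In the logarithmic chart `x = exp (-ζ)` and `ℓ = 1 / ζ`. -/
structure IsDulacGerm (f : ℝ → ℝ) (α : ℕ → ℝ) (P : ℕ → LaurentPolynomial ℝ) : Prop where
  finiteType : IsFiniteType α
  analytic : ∃ ε > 0, AnalyticOnNhd ℝ f (Set.Ioo 0 ε)
  expansion : ∀ n : ℕ,
    (fun x : ℝ => f x -
      ∑ i ∈ Finset.range (n + 1), evalLaurent (P i) (-(Real.log x)⁻¹) * x ^ α i)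
      =o[𝓝[>] 0] fun x : ℝ => x ^ α n
  quasiAnalytic : ∃ (C r : ℝ) (F : ℂ → ℂ), 0 < C ∧
    AnalyticOnNhd ℂ F (quadraticDomain C r) ∧
    (∀ᶠ x : ℝ in 𝓝[>] 0, F ((-Real.log x : ℝ) : ℂ) = (f x : ℂ)) ∧
    ∀ n : ℕ,
      (fun ζ : ℂ => F ζ -
        ∑ i ∈ Finset.range (n + 1), evalLaurent (P i) ζ⁻¹ * Complex.exp (-(α i : ℂ) * ζ))
        =o[Filter.comap Complex.re Filter.atTop ⊓ Filter.principal (quadraticDomain C r)]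
        fun ζ : ℂ => Complex.exp (-(α n : ℂ) * ζ)

/-- `f` is a parabolic Dulac germ and `fhat` is its Dulac expansion. -/
def IsParabolicDulacGerm (f : ℝ → ℝ) (fhat : Transseries) : Prop :=
  ∃ (α : ℕ → ℝ) (P : ℕ → LaurentPolynomial ℝ), IsDulacGerm f α P ∧
    α 0 = 1 ∧ P 0 = 1 ∧ (∃ i, 0 < i ∧ P i ≠ 0) ∧
    IsFormalSum (fun i => polyBlock (α i) (P i)) fhat

end Dulac

end

/-!
In the logarithmic chart `x = exp (-ζ)` a parabolic `f = x * u₀` acts as a translation by `-τ`,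
where `τ = log u₀` is infinitesimal, so composition with `f` is given by Taylor's formula
`Ψ ∘ f = ∑ τ ^ k / k! * D ^ k Ψ` with `D = x d/dx` (`isComp_taylorOp`). This is verified on the
monomials `x ^ a * ℓ ^ n` (`n` an integer) and `ℓ₂⁻¹`, which are all that is needed, and extends to
their formal sums because the Taylor operator moves supports only by a fixed well-ordered set of
exponents.

The Abel equation `Ψ ∘ f - Ψ = 1` thereby becomes the equation
`∑ τ ^ (k + 1) / (k + 1)! * D ^ k G = 1` for `G = D Ψ`. If `x ^ δ * q(ℓ)` is the first block of `τ`,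
the left side is multiplication by `x ^ δ * q(ℓ)` up to an operator that raises the order in `x` by
a fixed positive amount, and a Neumann series gives `G` (`exists_derivative_solution`). The blocks
of `τ` are rational functions of `ℓ`, because those of `f` are Laurent polynomials, and rationality
is preserved by products, by `D` and by limits; hence the blocks of `G` are rational.

Integrating block by block (`exists_eulerD_eq`), the equation `a F + ℓ² F' = R` is always solvable
in Laurent series for `a ≠ 0`, and for `a = 0` up to a multiple of `ℓ`. That residue is `D` of a
multiple of `ℓ₂⁻¹`, and this is the only way in which an iterated logarithm enters. The exponents
stay in a translate of a finitely generated semigroup since subtracting a constant from the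
elements above it does not lead out of the finitely generated semigroups
(`exists_closure_sub_mem`).

Uniqueness (`eq_C_of_isComp_self`) is a comparison of leading terms in all iterated logarithms at
once: composing a monomial `γ ≠ 1` with `f` changes it by a series whose leading exponent is a
strictly increasing function of `γ`, so the first nonconstant monomial of an invariant transseries
could not be cancelled.
-/

noncomputable section

namespace Dulac

open HahnSeries
open scoped Pointwise


/-! ### Power series identities -/

theorem coeff_pow_eq_zero_of_lt {p : PowerSeries ℝ} (hp : PowerSeries.constantCoeff p = 0)
    {n d : ℕ} (h : n < d) : PowerSeries.coeff n (p ^ d) = 0 := by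
  obtain ⟨q, rfl⟩ := PowerSeries.X_dvd_iff.2 hp
  rw [mul_pow, PowerSeries.coeff_X_pow_mul', if_neg (not_le.2 h)]

/-- The differential equation `(1 + X) y' = a y` of the binomial series. -/
theorem one_add_X_mul_derivative_binomialSeries (a : ℝ) :
    (1 + PowerSeries.X) * PowerSeries.derivative ℝ (PowerSeries.binomialSeries ℝ a) =
      PowerSeries.C a * PowerSeries.binomialSeries ℝ a := by
  have key : ∀ n : ℕ, Ring.choose a (n + 1) * (n + 1) = (a - n) * Ring.choose a n := by
    intro n
    have h1 := Ring.descPochhammer_eq_factorial_smul_choose a (n + 1)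
    have h2 := Ring.descPochhammer_eq_factorial_smul_choose a n
    rw [descPochhammer_succ_right, Polynomial.smeval_mul, h2] at h1
    simp only [Polynomial.smeval_sub, Polynomial.smeval_X, pow_one, Polynomial.smeval_natCast,
      pow_zero, nsmul_eq_mul, Nat.factorial_succ, Nat.cast_mul] at h1
    have hn : (n.factorial : ℝ) ≠ 0 := by positivity
    apply mul_left_cancel₀ hn
    push_cast at h1 ⊢
    linarith
  ext n
  rw [add_mul, one_mul, map_add, PowerSeries.coeff_C_mul, PowerSeries.coeff_derivative]
  cases n with
  | zero =>
    have := key 0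
    simp at this ⊢
  | succ n =>
    rw [PowerSeries.coeff_succ_X_mul, PowerSeries.coeff_derivative]
    have := key (n + 1)
    simp only [PowerSeries.binomialSeries_coeff, smul_eq_mul, mul_one]
    push_cast at this ⊢
    linarith

theorem one_add_X_mul_derivative_log :
    (1 + PowerSeries.X) * PowerSeries.derivative ℝ (PowerSeries.log ℝ) = 1 := by
  rw [PowerSeries.deriv_log]
  ext n
  rw [add_mul, one_mul, map_add]
  cases n with
  | zero => simp
  | succ n => rw [PowerSeries.coeff_succ_X_mul]; simp [pow_succ, PowerSeries.coeff_one]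

theorem hasSubst_log : PowerSeries.HasSubst (PowerSeries.log ℝ) := PowerSeries.HasSubst.log

/-- The exponential series of `a * Z`. -/
def expSeries (a : ℝ) : PowerSeries ℝ := PowerSeries.mk fun k => (k.factorial : ℝ)⁻¹ * a ^ k

theorem derivative_expSeries (a : ℝ) :
    PowerSeries.derivative ℝ (expSeries a) = PowerSeries.C a * expSeries a := by
  ext n
  rw [PowerSeries.coeff_derivative, PowerSeries.coeff_C_mul]
  simp only [expSeries, PowerSeries.coeff_mk, Nat.factorial_succ, pow_succ]
  push_cast
  field_simp

/-- `exp (a * log (1 + X)) = (1 + X) ^ a`. -/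
theorem expSeries_subst_log (a : ℝ) :
    (expSeries a).subst (PowerSeries.log ℝ) = PowerSeries.binomialSeries ℝ a := by
  set E := (expSeries a).subst (PowerSeries.log ℝ) with hE
  set B := PowerSeries.binomialSeries ℝ a
  set B' := PowerSeries.binomialSeries ℝ (-a)
  have hBB : B * B' = 1 := by
    rw [← PowerSeries.binomialSeries_add]; simp
  have hdE : (1 + PowerSeries.X) * PowerSeries.derivative ℝ E = PowerSeries.C a * E := by
    have hC : (PowerSeries.C a : PowerSeries ℝ).subst (PowerSeries.log ℝ) = PowerSeries.C a :=
      PowerSeries.subst_C a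
    rw [hE, PowerSeries.derivative_subst hasSubst_log, derivative_expSeries,
      PowerSeries.subst_mul hasSubst_log, hC]
    linear_combination (PowerSeries.C a * (expSeries a).subst (PowerSeries.log ℝ)) *
      one_add_X_mul_derivative_log
  have hdB := one_add_X_mul_derivative_binomialSeries (-a)
  have hone : IsUnit (1 + PowerSeries.X : PowerSeries ℝ) := by
    rw [PowerSeries.isUnit_iff_constantCoeff]; simp
  have hy : B' * E = 1 := by
    apply PowerSeries.derivative.ext
    · apply hone.mul_left_cancel
      rw [Derivation.leibniz, Derivation.map_one_eq_zero]
      simp only [smul_eq_mul]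
      rw [map_neg] at hdB
      linear_combination B' * hdE + E * hdB
    · have h1 : PowerSeries.constantCoeff E = 1 := by
        have h0 : PowerSeries.constantCoeff (expSeries a) = 1 := by
          rw [← PowerSeries.coeff_zero_eq_constantCoeff_apply]; simp [expSeries]
        have h := PowerSeries.constantCoeff_subst_eq_zero
          (PowerSeries.constantCoeff_log (A := ℝ)) (expSeries a - PowerSeries.C 1)
          (by rw [map_sub, h0]; simp)
        rw [PowerSeries.subst_sub hasSubst_log] at h
        have hC : (PowerSeries.C 1 : PowerSeries ℝ).subst (PowerSeries.log ℝ) = PowerSeries.C 1 :=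
          PowerSeries.subst_C (1 : ℝ)
        rw [hC] at h
        have h' : PowerSeries.constantCoeff (E - PowerSeries.C 1) = 0 := h
        rw [map_sub, PowerSeries.constantCoeff_C, sub_eq_zero] at h'
        exact h'
      rw [map_mul, h1]; simp [B']
  calc E = B * B' * E := by rw [hBB, one_mul]
    _ = B * (B' * E) := by ring
    _ = B := by rw [hy, mul_one]

/-- The series `∑ Z ^ k / (k + 1) = -log (1 - Z) / Z`. -/
def logQuot : PowerSeries ℝ := PowerSeries.mk fun k => ((k : ℝ) + 1)⁻¹

/-- The geometric series. -/
def geom : PowerSeries ℝ := PowerSeries.mk fun _ => 1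

theorem geom_mul : geom * (1 - PowerSeries.X) = 1 := PowerSeries.mk_one_mul_one_sub_eq_one ℝ

/-- `log (1 / (1 - Z)) = ∑ Z ^ (k + 1) / (k + 1)`. -/
theorem log_subst_geom :
    (PowerSeries.log ℝ).subst (geom - 1) = PowerSeries.X * logQuot := by
  have h0 : PowerSeries.constantCoeff (geom - 1) = 0 := by
    rw [← PowerSeries.coeff_zero_eq_constantCoeff_apply, map_sub]; simp [geom]
  have hs : PowerSeries.HasSubst (geom - 1) := PowerSeries.HasSubst.of_constantCoeff_zero' h0
  have hunit : IsUnit (1 - PowerSeries.X : PowerSeries ℝ) := by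
    rw [PowerSeries.isUnit_iff_constantCoeff]; simp
  apply PowerSeries.derivative.ext
  · have e1 : PowerSeries.derivative ℝ (PowerSeries.X * logQuot) = geom := by
      ext n
      rw [PowerSeries.coeff_derivative, PowerSeries.coeff_succ_X_mul]
      simp only [logQuot, geom, PowerSeries.coeff_mk]
      field_simp
    have e2 : PowerSeries.derivative ℝ geom * (1 - PowerSeries.X) = geom := by
      have := congrArg (PowerSeries.derivative ℝ) geom_mul
      rw [Derivation.leibniz, Derivation.map_one_eq_zero, map_sub, Derivation.map_one_eq_zero,
        PowerSeries.derivative_X] at this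
      simp only [smul_eq_mul] at this
      linear_combination this
    have e3 : geom * ((PowerSeries.derivative ℝ (PowerSeries.log ℝ)).subst (geom - 1)) = 1 := by
      have := congrArg (PowerSeries.subst (geom - 1)) one_add_X_mul_derivative_log
      have h1 : PowerSeries.subst (geom - 1) (1 : PowerSeries ℝ) = (1 : PowerSeries ℝ) := by
        rw [← PowerSeries.coe_substAlgHom hs, map_one]
      rw [PowerSeries.subst_mul hs, PowerSeries.subst_add hs, PowerSeries.subst_X hs, h1] at this
      linear_combination this
    rw [PowerSeries.derivative_subst hs, e1, map_sub, Derivation.map_one_eq_zero, sub_zero]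
    set u := (PowerSeries.derivative ℝ (PowerSeries.log ℝ)).subst (geom - 1)
    have e4 : PowerSeries.derivative ℝ geom = geom * geom := by
      linear_combination geom * e2 - PowerSeries.derivative ℝ geom * geom_mul
    rw [e4]
    linear_combination geom * e3
  · rw [map_mul, PowerSeries.constantCoeff_X, zero_mul]
    exact PowerSeries.constantCoeff_subst_eq_zero h0 _ PowerSeries.constantCoeff_log

/-! ### Summable families of generalized power series -/

section Hahn

set_option linter.unusedSectionVars false

variable {Γ : Type*} [AddCommGroup Γ] [LinearOrder Γ] [IsOrderedAddMonoid Γ]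

/-- The products `s i * t i` of a summable family `s` with series `t i` whose supports lie in one
well-ordered set form a summable family. -/
def mulBounded {ι : Type*} (s : SummableFamily Γ ℝ ι) (t : ι → HahnSeries Γ ℝ) {P : Set Γ}
    (hP : P.IsPWO) (ht : ∀ i, (t i).support ⊆ P) : SummableFamily Γ ℝ ι where
  toFun i := s i * t i
  isPWO_iUnion_support' := by
    refine (s.isPWO_iUnion_support.add hP).mono (Set.iUnion_subset fun i => ?_)
    exact support_mul_subset.trans
      (Set.add_subset_add (Set.subset_iUnion (fun i => (s i).support) i) (ht i))
  finite_co_support' g := by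
    refine ((Finset.antidiagonal s.isPWO_iUnion_support hP g).finite_toSet.biUnion
      fun p _ => s.finite_co_support p.1).subset ?_
    intro i hi
    obtain ⟨a, ha, b, hb, rfl⟩ := support_mul_subset (show g ∈ (s i * t i).support from hi)
    refine Set.mem_biUnion (x := (a, b)) ?_ ha
    rw [Finset.mem_coe, Finset.mem_antidiagonal]
    exact ⟨Set.mem_iUnion.2 ⟨i, ha⟩, ht i hb, rfl⟩

@[simp]
theorem mulBounded_apply {ι : Type*} (s : SummableFamily Γ ℝ ι) (t : ι → HahnSeries Γ ℝ) {P : Set Γ}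
    (hP : P.IsPWO) (ht : ∀ i, (t i).support ⊆ P) (i : ι) : mulBounded s t hP ht i = s i * t i := rfl

/-- The first term of a sum over `ℕ` can be split off. -/
theorem hsum_eq_zero_add {s t : SummableFamily Γ ℝ ℕ} (h : ∀ n, t n = s (n + 1)) :
    s.hsum = s 0 + t.hsum := by
  have : s = SummableFamily.single 0 (s 0) + t.embDomain ⟨Nat.succ, Nat.succ_injective⟩ := by
    ext1 n
    cases n with
    | zero =>
      rw [SummableFamily.add_apply, SummableFamily.embDomain_of_notMem_range]
      · simp
      · simp
    | succ n =>
      have := SummableFamily.embDomain_image (s := t) (f := ⟨Nat.succ, Nat.succ_injective⟩) (a := n)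
      rw [SummableFamily.add_apply]
      simp only [Function.Embedding.coeFn_mk, Nat.succ_eq_add_one] at this
      rw [this, h]
      simp
  conv_lhs => rw [this]
  rw [SummableFamily.hsum_add, SummableFamily.hsum_single, SummableFamily.hsum_embDomain]

/-- A linear operator which moves supports only by a fixed well-ordered set of exponents is
strongly linear: it may be applied to a series monomial by monomial. -/
theorem exists_summableFamily_of_support_subset (L : HahnSeries Γ ℝ →ₗ[ℝ] HahnSeries Γ ℝ)
    {S : Set Γ} (hS : S.IsPWO) (hL : ∀ h, (L h).support ⊆ h.support + S) (h : HahnSeries Γ ℝ) :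
    ∃ F : SummableFamily Γ ℝ Γ, (∀ γ, F γ = C (h.coeff γ) * L (single γ 1)) ∧ F.hsum = L h := by
  have hterm : ∀ γ, C (h.coeff γ) * L (single γ 1) = L (single γ (h.coeff γ)) := by
    intro γ
    rw [C_mul_eq_smul, ← map_smul]
    congr 1
    ext e
    simp [coeff_single]
  have hmem : ∀ γ e, (C (h.coeff γ) * L (single γ 1)).coeff e ≠ 0 →
      γ ∈ h.support ∧ ∃ s ∈ S, γ + s = e := by
    intro γ e hne
    rw [hterm] at hne
    obtain ⟨a, ha, s, hs, rfl⟩ := hL _ (show e ∈ (L (single γ (h.coeff γ))).support from hne)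
    have haγ : a = γ := by
      by_contra hcon
      rw [mem_support, coeff_single_of_ne hcon] at ha
      exact ha rfl
    subst haγ
    refine ⟨?_, s, hs, rfl⟩
    rw [mem_support, coeff_single_same] at ha
    exact ha
  let A : Γ → Finset Γ := fun e =>
    (Finset.antidiagonal h.isPWO_support hS e).image Prod.fst
  have hA : ∀ γ e, γ ∈ h.support → (∃ s ∈ S, γ + s = e) → γ ∈ A e := by
    rintro γ e hγ ⟨s, hs, hse⟩
    refine Finset.mem_image.2 ⟨(γ, s), ?_, rfl⟩
    rw [Finset.mem_antidiagonal]
    exact ⟨hγ, hs, hse⟩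
  let F : SummableFamily Γ ℝ Γ :=
    { toFun := fun γ => C (h.coeff γ) * L (single γ 1)
      isPWO_iUnion_support' := by
        refine (h.isPWO_support.add hS).mono (Set.iUnion_subset fun γ => ?_)
        intro e he
        obtain ⟨h1, s, hs, rfl⟩ := hmem γ e he
        exact Set.add_mem_add h1 hs
      finite_co_support' := fun e => by
        refine (A e).finite_toSet.subset fun γ hγ => ?_
        obtain ⟨h1, h2⟩ := hmem γ e hγ
        exact hA γ e h1 h2 }
  refine ⟨F, fun γ => rfl, ?_⟩
  ext e
  have hsub : {γ | (F γ).coeff e ≠ 0} ⊆ A e := fun γ hγ => by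
    obtain ⟨h1, h2⟩ := hmem γ e hγ
    exact hA γ e h1 h2
  rw [SummableFamily.coeff_hsum_eq_sum_of_subset hsub]
  -- only the monomials in the finite set `A e` contribute to the coefficient at `e`
  set r := h - ∑ γ ∈ A e, single γ (h.coeff γ) with hr
  have hrc : ∀ γ, r.coeff γ = if γ ∈ A e then 0 else h.coeff γ := by
    intro γ
    rw [hr, coeff_sub, HahnSeries.coeff_sum]
    split_ifs with hγ
    · rw [Finset.sum_eq_single γ (fun b _ hb => coeff_single_of_ne hb.symm) fun h => absurd hγ h,
        coeff_single_same, sub_self]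
    · rw [Finset.sum_eq_zero fun b hb => coeff_single_of_ne (by rintro rfl; exact hγ hb), sub_zero]
  have hLr : (L r).coeff e = 0 := by
    by_contra hne
    obtain ⟨a, ha, s, hs, hse⟩ := hL _ (show e ∈ (L r).support from hne)
    rw [mem_support, hrc] at ha
    split_ifs at ha with hmemA
    · exact ha rfl
    · exact hmemA (hA a e ha ⟨s, hs, hse⟩)
  have hh : h = r + ∑ γ ∈ A e, single γ (h.coeff γ) := by rw [hr]; abel
  conv_rhs => rw [hh]
  rw [map_add, map_sum, coeff_add, hLr, zero_add, HahnSeries.coeff_sum]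
  exact Finset.sum_congr rfl fun γ _ => by rw [← hterm]; rfl

/-! ### Evaluation of power series at an infinitesimal -/

/-- Splitting off the constant term of a power series evaluated at `x`; iterated, this gives
expansions with remainder `x ^ K * (⋯)`. -/
theorem heval_eq_C_add (x : HahnSeries Γ ℝ) (hx : 0 < x.orderTop) (p : PowerSeries ℝ) :
    ∃ q : PowerSeries ℝ, PowerSeries.heval x p = C (PowerSeries.constantCoeff p) +
      x * PowerSeries.heval x q := by
  refine ⟨PowerSeries.mk fun n => PowerSeries.coeff (n + 1) p, ?_⟩
  conv_lhs => rw [PowerSeries.eq_X_mul_shift_add_const p]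
  rw [map_add, map_mul, PowerSeries.heval_X _ hx, PowerSeries.heval_C, add_comm, C_eq_algebraMap,
    Algebra.algebraMap_eq_smul_one]

theorem support_heval_subset (x : HahnSeries Γ ℝ) (p : PowerSeries ℝ) :
    (PowerSeries.heval x p).support ⊆ AddSubmonoid.closure x.support := by
  rw [PowerSeries.heval_apply]
  refine SummableFamily.support_hsum_subset.trans (Set.iUnion_subset fun n => ?_)
  intro γ hγ
  by_cases hx : 0 < x.orderTop
  · rw [SummableFamily.powerSeriesFamily_of_orderTop_pos hx] at hγ
    refine SummableFamily.support_pow_subset_closure x n ?_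
    rw [mem_support, HahnSeries.coeff_smul] at hγ
    exact right_ne_zero_of_smul hγ
  · rw [mem_support] at hγ
    simp only [SummableFamily.smulFamily_toFun, SummableFamily.powers_of_not_orderTop_pos hx,
      HahnSeries.coeff_smul] at hγ
    have h2 := right_ne_zero_of_smul hγ
    rcases eq_or_ne n 0 with rfl | hn
    · simp only [SummableFamily.single_toFun, Pi.single_eq_same, coeff_one] at h2
      have : γ = 0 := by
        by_contra hne
        simp [hne] at h2
      rw [this]; exact zero_mem _
    · simp [hn] at h2

/-- Evaluation at an infinitesimal is compatible with composition of power series. -/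
theorem heval_subst (x : HahnSeries Γ ℝ) (hx : 0 < x.orderTop) (p q : PowerSeries ℝ)
    (hp : PowerSeries.constantCoeff p = 0) (hpx : 0 < (PowerSeries.heval x p).orderTop) :
    PowerSeries.heval x (q.subst p) = PowerSeries.heval (PowerSeries.heval x p) q := by
  ext γ
  obtain ⟨N, hN⟩ : ∃ N : ℕ, ∀ n, (x ^ n).coeff γ ≠ 0 → n < N := by
    obtain ⟨N, hN⟩ := (SummableFamily.pow_finite_co_support hx γ).bddAbove
    exact ⟨N + 1, fun n hn => Nat.lt_succ_of_le (hN hn)⟩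
  have hev : ∀ r : PowerSeries ℝ, (PowerSeries.heval x r).coeff γ =
      ∑ n ∈ Finset.range N, PowerSeries.coeff n r * (x ^ n).coeff γ := by
    intro r
    rw [PowerSeries.heval_apply, SummableFamily.coeff_hsum_eq_sum_of_subset (t := Finset.range N)]
    · refine Finset.sum_congr rfl fun n _ => ?_
      rw [SummableFamily.powerSeriesFamily_of_orderTop_pos hx, HahnSeries.coeff_smul, smul_eq_mul]
    · intro n hn
      rw [Set.mem_ofPred_eq, SummableFamily.powerSeriesFamily_of_orderTop_pos hx,
        HahnSeries.coeff_smul] at hn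
      exact Finset.mem_coe.2 (Finset.mem_range.2 (hN n (right_ne_zero_of_smul hn)))
  have hpow : ∀ d, N ≤ d → ((PowerSeries.heval x p) ^ d).coeff γ = 0 := by
    intro d hd
    rw [← map_pow, hev]
    refine Finset.sum_eq_zero fun n hn => ?_
    rw [coeff_pow_eq_zero_of_lt hp ((Finset.mem_range.1 hn).trans_le hd), zero_mul]
  have hs : PowerSeries.HasSubst p := PowerSeries.HasSubst.of_constantCoeff_zero' hp
  have hcs : ∀ n < N, PowerSeries.coeff n (q.subst p : PowerSeries ℝ) =
      ∑ d ∈ Finset.range N, PowerSeries.coeff d q * PowerSeries.coeff n (p ^ d) := by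
    intro n hn
    rw [PowerSeries.coeff_subst' hs, finsum_eq_sum_of_support_subset (s := Finset.range N)]
    · rfl
    · intro d hd
      rw [Function.mem_support] at hd
      by_contra hcon
      have hcon' : N ≤ d := by simpa using hcon
      rw [coeff_pow_eq_zero_of_lt hp (hn.trans_le hcon')] at hd
      simp at hd
  rw [hev, PowerSeries.heval_apply (PowerSeries.heval x p),
    SummableFamily.coeff_hsum_eq_sum_of_subset (t := Finset.range N)]
  · rw [Finset.sum_congr rfl fun n hn => by rw [hcs n (Finset.mem_range.1 hn), Finset.sum_mul],
      Finset.sum_comm]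
    refine Finset.sum_congr rfl fun d _ => ?_
    rw [SummableFamily.powerSeriesFamily_of_orderTop_pos hpx, HahnSeries.coeff_smul, smul_eq_mul,
      ← map_pow, hev, Finset.mul_sum]
    exact Finset.sum_congr rfl fun n _ => by ring
  · intro d hd
    rw [Set.mem_ofPred_eq, SummableFamily.powerSeriesFamily_of_orderTop_pos hpx,
      HahnSeries.coeff_smul] at hd
    by_contra hcon
    exact right_ne_zero_of_smul hd (hpow d (by simpa using hcon))

/-! ### Leading terms -/

/-- `g = c * t ^ e + (terms of larger exponent)`, where `c` may vanish. -/
def Leads (g : HahnSeries Γ ℝ) (e : Γ) (c : ℝ) : Prop :=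
  g.coeff e = c ∧ ∀ e' < e, g.coeff e' = 0

theorem Leads.le_of_ne {g : HahnSeries Γ ℝ} {e : Γ} {c : ℝ} (h : Leads g e c) {e' : Γ}
    (h' : g.coeff e' ≠ 0) : e ≤ e' := by
  by_contra hcon
  exact h' (h.2 e' (not_le.1 hcon))

theorem Leads.orderTop_pos {g : HahnSeries Γ ℝ} {e : Γ} {c : ℝ} (h : Leads g e c) (he : 0 < e) :
    0 < g.orderTop := by
  by_cases hg : g = 0
  · simp [hg]
  · rw [zero_lt_orderTop_iff hg]
    refine he.trans_le (h.le_of_ne ?_)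
    exact fun hc => hg (HahnSeries.coeff_order_eq_zero.1 hc)

theorem Leads.mono {g : HahnSeries Γ ℝ} {e e' : Γ} {c : ℝ} (h : Leads g e c) (he : e' < e) :
    Leads g e' 0 :=
  ⟨h.2 e' he, fun e'' h'' => h.2 e'' (h''.trans he)⟩

theorem Leads.add {g g' : HahnSeries Γ ℝ} {e : Γ} {c c' : ℝ} (h : Leads g e c)
    (h' : Leads g' e c') : Leads (g + g') e (c + c') :=
  ⟨by rw [coeff_add, h.1, h'.1], fun e'' h'' => by rw [coeff_add, h.2 e'' h'', h'.2 e'' h'', add_zero]⟩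

theorem Leads.mul {g g' : HahnSeries Γ ℝ} {e e' : Γ} {c c' : ℝ} (h : Leads g e c)
    (h' : Leads g' e' c') : Leads (g * g') (e + e') (c * c') := by
  have key : ∀ d ≤ e + e', (g * g').coeff d = if d = e + e' then c * c' else 0 := by
    intro d hd
    rw [coeff_mul]
    split_ifs with hde
    · rw [Finset.sum_eq_single (e, e')]
      · rw [h.1, h'.1]
      · rintro ⟨a, b⟩ hab hne
        rw [Finset.mem_antidiagonal] at hab
        obtain ⟨ha, hb, hs⟩ := hab
        have ha' := h.le_of_ne ha
        have hb' := h'.le_of_ne hb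
        simp only at hs ha' hb'
        exfalso
        apply hne
        have h1 : a = e := by
          refine le_antisymm ?_ ha'
          by_contra hlt
          have := add_lt_add_of_lt_of_le (not_le.1 hlt) hb'
          rw [hs, hde] at this
          exact lt_irrefl _ this
        rw [h1, hde] at hs
        rw [h1, add_left_cancel hs]
      · intro hnm
        rw [Finset.mem_antidiagonal] at hnm
        by_contra hne
        apply hnm
        exact ⟨left_ne_zero_of_mul hne, right_ne_zero_of_mul hne, hde.symm⟩
    · refine Finset.sum_eq_zero ?_
      rintro ⟨a, b⟩ hab
      rw [Finset.mem_antidiagonal] at hab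
      obtain ⟨ha, hb, hs⟩ := hab
      have := add_le_add (h.le_of_ne ha) (h'.le_of_ne hb)
      simp only at hs this
      rw [hs] at this
      exact absurd (le_antisymm hd this) hde
  refine ⟨by rw [key _ le_rfl, if_pos rfl], fun d hd => by rw [key d hd.le, if_neg hd.ne]⟩

theorem leads_single (e : Γ) (c : ℝ) : Leads (single e c) e c :=
  ⟨coeff_single_same _ _, fun _ he => coeff_single_of_ne he.ne⟩

/-- `p(x) = p(0) + p'(0) * x + ⋯`, where only the leading term of `x` is kept. -/
theorem Leads.heval {x : HahnSeries Γ ℝ} {e : Γ} {c : ℝ} (h : Leads x e c) (he : 0 < e)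
    (p : PowerSeries ℝ) : Leads (PowerSeries.heval x p - C (PowerSeries.constantCoeff p)) e
      (PowerSeries.coeff 1 p * c) := by
  have hx := h.orderTop_pos he
  have hshift : ∀ q : PowerSeries ℝ, Leads (PowerSeries.heval x q) 0
      (PowerSeries.constantCoeff q) := by
    intro q
    refine ⟨PowerSeries.coeff_heval_zero x q, fun e' he' => ?_⟩
    by_contra hne
    have hmem := support_heval_subset x q hne
    have : ∀ y ∈ AddSubmonoid.closure x.support, 0 ≤ y := by
      intro y hy
      induction hy using AddSubmonoid.closure_induction with
      | mem z hz => exact he.le.trans (h.le_of_ne hz)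
      | zero => exact le_rfl
      | add a b _ _ ha hb => exact add_nonneg ha hb
    exact absurd (this e' hmem) (not_le.2 he')
  have := h.mul (hshift (PowerSeries.mk fun n => PowerSeries.coeff (n + 1) p))
  rw [add_zero, ← PowerSeries.coeff_zero_eq_constantCoeff_apply, PowerSeries.coeff_mk, zero_add,
    mul_comm c] at this
  convert this using 1
  conv_lhs => rw [PowerSeries.eq_X_mul_shift_add_const p]
  rw [map_add, map_mul, PowerSeries.heval_X _ hx, PowerSeries.heval_C]
  simp [C_eq_algebraMap, Algebra.algebraMap_eq_smul_one]

/-- If every factor is `1 + c i * t ^ e + ⋯`, the product is `1 + (∑ c i) * t ^ e + ⋯`. -/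
theorem Leads.prod_sub_one {ι : Type*} (s : Finset ι) (v : ι → HahnSeries Γ ℝ) (c : ι → ℝ) {e : Γ}
    (he : 0 < e) (h : ∀ i ∈ s, Leads (v i - 1) e (c i)) :
    Leads (∏ i ∈ s, v i - 1) e (∑ i ∈ s, c i) := by
  classical
  induction s using Finset.induction_on with
  | empty => simp only [Finset.prod_empty, sub_self, Finset.sum_empty]; exact ⟨rfl, fun _ _ => rfl⟩
  | insert i s hi ih =>
    rw [Finset.prod_insert hi, Finset.sum_insert hi]
    have h1 := h i (Finset.mem_insert_self i s)
    have h2 := ih fun j hj => h j (Finset.mem_insert_of_mem hj)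
    have h3 := ((h1.mul h2).mono (lt_add_of_pos_left e he)).add (h1.add h2)
    rw [zero_add] at h3
    convert h3 using 1
    ring

theorem Leads.inv_one_sub {x : HahnSeries Γ ℝ} {e : Γ} {c : ℝ} (h : Leads x e c) (he : 0 < e) :
    (1 - x)⁻¹ = PowerSeries.heval x geom ∧ Leads ((1 - x)⁻¹ - 1) e c := by
  have hx := h.orderTop_pos he
  have h1 : PowerSeries.heval x geom * (1 - x) = 1 := by
    have := congrArg (PowerSeries.heval x) geom_mul
    rwa [map_mul, map_sub, map_one, PowerSeries.heval_X _ hx] at this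
  have h2 : (1 - x)⁻¹ = PowerSeries.heval x geom := (eq_inv_of_mul_eq_one_left h1).symm
  refine ⟨h2, ?_⟩
  have := h.heval he geom
  rw [h2]
  simpa [geom, ← PowerSeries.coeff_zero_eq_constantCoeff_apply,
    -PowerSeries.coeff_zero_eq_constantCoeff] using this

end Hahn

/-! ### Leading terms of composed monomials, and uniqueness -/

theorem expo_apply (k : ℕ) (a : ℝ) (i : ℕ) : ofLex (expo k a) i = if k = i then a else 0 := by
  simp [expo, Finsupp.single_apply]

theorem expo_add (k : ℕ) (a b : ℝ) : expo k (a + b) = expo k a + expo k b := by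
  simp [expo]

theorem expo_zero (k : ℕ) : expo k 0 = 0 := by
  simp [expo]

theorem ofLex_add_apply (γ γ' : Expo) (i : ℕ) : ofLex (γ + γ') i = ofLex γ i + ofLex γ' i := rfl

theorem ofLex_zero_apply (i : ℕ) : ofLex (0 : Expo) i = 0 := rfl

theorem expo_ext {γ γ' : Expo} (h : ∀ i, ofLex γ i = ofLex γ' i) : γ = γ' :=
  ofLex_inj.1 (Finsupp.ext h)

theorem expo_pos (k : ℕ) {a : ℝ} (ha : 0 < a) : 0 < expo k a := by
  rw [Finsupp.Lex.lt_iff]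
  refine ⟨k, fun i hi => ?_, ?_⟩
  · rw [expo_apply, if_neg hi.ne']; rfl
  · rw [expo_apply, if_pos rfl]; exact ha

theorem expo_lt_of_first {γ γ' : Expo} (h : ofLex γ 0 < ofLex γ' 0) : γ < γ' := by
  rw [Finsupp.Lex.lt_iff]
  exact ⟨0, fun i hi => absurd hi (Nat.not_lt_zero i), h⟩

theorem first_le_of_le {γ γ' : Expo} (h : γ ≤ γ') : ofLex γ 0 ≤ ofLex γ' 0 := by
  by_contra hcon
  exact absurd (expo_lt_of_first (not_le.1 hcon)) (not_lt.2 h)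

/-- The exponent of `ℓ₁ ⋯ ℓ_k`. -/
def ellProdExpo (k : ℕ) : Expo := ∑ i ∈ Finset.Icc 1 k, expo i 1

theorem ellProdExpo_succ (k : ℕ) : ellProdExpo (k + 1) = ellProdExpo k + expo (k + 1) 1 := by
  rw [ellProdExpo, Finset.sum_Icc_succ_top (by omega)]; rfl

theorem ellProdExpo_zero : ellProdExpo 0 = 0 := by simp [ellProdExpo]

theorem ellProdExpo_apply (k i : ℕ) :
    ofLex (ellProdExpo k) i = if 1 ≤ i ∧ i ≤ k then 1 else 0 := by
  induction k with
  | zero =>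
    rw [ellProdExpo_zero, ofLex_zero_apply, if_neg (by omega)]
  | succ k ih =>
    rw [ellProdExpo_succ, ofLex_add_apply, ih, expo_apply]
    by_cases h1 : k + 1 = i
    · rw [if_neg (by omega), if_pos h1, if_pos (by omega), zero_add]
    · rw [if_neg h1, add_zero]
      by_cases h2 : 1 ≤ i ∧ i ≤ k
      · rw [if_pos h2, if_pos (by omega)]
      · rw [if_neg h2, if_neg (by omega)]

theorem ellProdExpo_strictMono : StrictMono ellProdExpo :=
  strictMono_nat_of_lt_succ fun k => by
    rw [ellProdExpo_succ]; exact lt_add_of_pos_right _ (expo_pos _ one_pos)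

theorem ellProdExpo_nonneg (k : ℕ) : 0 ≤ ellProdExpo k := by
  rw [← ellProdExpo_zero]; exact ellProdExpo_strictMono.monotone (Nat.zero_le k)

theorem Leads.formalLog {u : Transseries} {e : Expo} {c : ℝ} (h : Leads (u - 1) e c) (he : 0 < e) :
    Leads (formalLog u) e c := by
  have := h.heval he (PowerSeries.log ℝ)
  rw [PowerSeries.coeff_one_log, PowerSeries.constantCoeff_log, map_zero, sub_zero, one_mul] at this
  exact this

theorem Leads.realPow {u : Transseries} {e : Expo} {c : ℝ} (h : Leads (u - 1) e c) (he : 0 < e)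
    (a : ℝ) : Leads (realPow u a - 1) e (a * c) := by
  have := h.heval he (PowerSeries.binomialSeries ℝ a)
  simp only [PowerSeries.binomialSeries_coeff, PowerSeries.binomialSeries_constantCoeff, map_one,
    Ring.choose_one_right, smul_eq_mul, mul_one] at this
  exact this

/-- The factor `u_k = (ℓ_k ∘ f) / ℓ_k` is `1 + c * t ^ e * ℓ₁ ⋯ ℓ_k + ⋯`: each further logarithm
makes the displacement smaller by one factor `ℓ_i`. -/
theorem leads_ellFactor {f : Transseries} {e : Expo} {c : ℝ}
    (h : Leads (ellPow 0 (-1) * f - 1) e c) (he : 0 < e) (k : ℕ) :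
    Leads (ellFactor f k - 1) (e + ellProdExpo k) c := by
  induction k with
  | zero => rw [ellProdExpo_zero, add_zero]; exact h
  | succ k ih =>
    have hpos : 0 < e + ellProdExpo k := add_pos_of_pos_of_nonneg he (ellProdExpo_nonneg k)
    have h1 := (leads_single (expo (k + 1) 1) (1 : ℝ)).mul (ih.formalLog hpos)
    rw [one_mul] at h1
    have h2 := (h1.inv_one_sub (add_pos (expo_pos _ one_pos) hpos)).2
    rw [ellProdExpo_succ]
    rw [show e + (ellProdExpo k + expo (k + 1) 1) = expo (k + 1) 1 + (e + ellProdExpo k) by abel]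
    exact h2

theorem exists_first_ne {γ : Expo} (hγ : γ ≠ 0) :
    ∃ k, ofLex γ k ≠ 0 ∧ ∀ i < k, ofLex γ i = 0 := by
  classical
  have hex : ∃ k, ofLex γ k ≠ 0 := by
    by_contra hcon
    push Not at hcon
    exact hγ (expo_ext hcon)
  exact ⟨Nat.find hex, Nat.find_spec hex, fun i hi => not_not.1 (Nat.find_min hex hi)⟩

/-- If `f = x * (1 + c * t ^ e + ⋯)`, then composing a monomial `γ` with `f` changes it by a series
led by the exponent `γ + e` shifted by that of `ℓ₁ ⋯ ℓ_k`, `k` the first index with `γ_k ≠ 0`. -/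
theorem leads_monoComp_sub {f : Transseries} {e : Expo} {c : ℝ}
    (h : Leads (ellPow 0 (-1) * f - 1) e c) (he : 0 < e) {γ : Expo} {k : ℕ}
    (hk : ofLex γ k ≠ 0) (hlt : ∀ i < k, ofLex γ i = 0) :
    Leads (monoComp f γ - single γ 1) (γ + (e + ellProdExpo k)) (ofLex γ k * c) := by
  have hpos : 0 < e + ellProdExpo k := add_pos_of_pos_of_nonneg he (ellProdExpo_nonneg k)
  have h1 : Leads (∏ i ∈ (ofLex γ).support, realPow (ellFactor f i) (ofLex γ i) - 1)
      (e + ellProdExpo k) (∑ i ∈ (ofLex γ).support, if i = k then ofLex γ k * c else 0) := by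
    refine Leads.prod_sub_one _ _ _ hpos fun i hi => ?_
    have h2 := (leads_ellFactor h he i).realPow
      (add_pos_of_pos_of_nonneg he (ellProdExpo_nonneg i)) (ofLex γ i)
    split_ifs with hik
    · subst hik; exact h2
    · have hki : k < i := by
        by_contra hcon
        exact (Finsupp.mem_support_iff.1 hi) (hlt i (lt_of_le_of_ne (not_lt.1 hcon) hik))
      exact h2.mono (add_lt_add_right (ellProdExpo_strictMono hki) e)
  rw [Finset.sum_ite_eq' _ k, if_pos (Finsupp.mem_support_iff.2 hk)] at h1
  have h3 := (leads_single γ (1 : ℝ)).mul h1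
  rw [one_mul] at h3
  convert h3 using 1
  rw [monoComp, mul_sub, mul_one]

theorem monoComp_zero (f : Transseries) : monoComp f 0 = 1 := by
  simp [monoComp]

/-- The leading exponents of `leads_monoComp_sub` depend strictly monotonically on `γ ≠ 0`. -/
theorem add_ellProdExpo_lt {γ γ' : Expo} {k k' : ℕ} (hk : ofLex γ k ≠ 0)
    (hlt : ∀ i < k, ofLex γ i = 0) (hk' : ofLex γ' k' ≠ 0) (hlt' : ∀ i < k', ofLex γ' i = 0)
    (h : γ < γ') : γ + ellProdExpo k < γ' + ellProdExpo k' := by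
  obtain ⟨j, hj, hjlt⟩ := Finsupp.Lex.lt_iff.1 h
  rcases lt_trichotomy k k' with hkk | rfl | hkk
  · have hjk : j = k := by
      rcases lt_trichotomy j k with h1 | h1 | h1
      · exact absurd hjlt (by rw [hlt j h1, hlt' j (h1.trans hkk)]; exact lt_irrefl _)
      · exact h1
      · exact absurd ((hj k h1).trans (hlt' k hkk)) hk
    subst hjk
    rw [Finsupp.Lex.lt_iff]
    refine ⟨j, fun i hi => ?_, ?_⟩
    · rw [ofLex_add_apply, ofLex_add_apply, hj i hi, ellProdExpo_apply, ellProdExpo_apply]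
      congr 1
      by_cases hi1 : 1 ≤ i
      · rw [if_pos (by omega), if_pos (by omega)]
      · rw [if_neg (by omega), if_neg (by omega)]
    · rw [ofLex_add_apply, ofLex_add_apply, ellProdExpo_apply, ellProdExpo_apply]
      have : (if 1 ≤ j ∧ j ≤ j then (1 : ℝ) else 0) = if 1 ≤ j ∧ j ≤ k' then 1 else 0 := by
        by_cases hi1 : 1 ≤ j
        · rw [if_pos (by omega), if_pos (by omega)]
        · rw [if_neg (by omega), if_neg (by omega)]
      rw [this]
      linarith
  · exact add_lt_add_left h _
  · have hjk : j = k' := by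
      rcases lt_trichotomy j k' with h1 | h1 | h1
      · exact absurd hjlt (by rw [hlt j (h1.trans hkk), hlt' j h1]; exact lt_irrefl _)
      · exact h1
      · exact absurd ((hj k' h1).symm.trans (hlt k' hkk)) hk'
    subst hjk
    rw [Finsupp.Lex.lt_iff]
    refine ⟨j, fun i hi => ?_, ?_⟩
    · rw [ofLex_add_apply, ofLex_add_apply, hj i hi, ellProdExpo_apply, ellProdExpo_apply]
      congr 1
      by_cases hi1 : 1 ≤ i
      · rw [if_pos (by omega), if_pos (by omega)]
      · rw [if_neg (by omega), if_neg (by omega)]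
    · rw [ofLex_add_apply, ofLex_add_apply, ellProdExpo_apply, ellProdExpo_apply]
      have : (if 1 ≤ j ∧ j ≤ k then (1 : ℝ) else 0) = if 1 ≤ j ∧ j ≤ j then 1 else 0 := by
        by_cases hi1 : 1 ≤ j
        · rw [if_pos (by omega), if_pos (by omega)]
        · rw [if_neg (by omega), if_neg (by omega)]
      rw [this]
      linarith

/-- A transseries invariant under composition with a parabolic `f ≠ x` is constant: the leading
nonconstant monomial would survive in the difference. -/
theorem eq_C_of_isComp_self {f g : Transseries} {e : Expo} {c : ℝ}
    (h : Leads (ellPow 0 (-1) * f - 1) e c) (he : 0 < e) (hc : c ≠ 0) (hg : IsComp g f g) :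
    g = C (g.coeff 0) := by
  by_contra hne
  set r := g - C (g.coeff 0) with hr
  have hr0 : r ≠ 0 := sub_ne_zero.2 hne
  have hrc : ∀ γ, γ ≠ 0 → r.coeff γ = g.coeff γ := by
    intro γ hγ
    rw [hr, coeff_sub, C_apply, coeff_single_of_ne hγ, sub_zero]
  have hr00 : r.coeff 0 = 0 := by
    rw [hr, coeff_sub, C_apply, coeff_single_same, sub_self]
  set γ := r.order
  have hγr : r.coeff γ ≠ 0 := fun hc => hr0 (HahnSeries.coeff_order_eq_zero.1 hc)
  have hγ0 : γ ≠ 0 := fun h0 => hγr (by rw [h0, hr00])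
  have hmin : ∀ γ', γ' ≠ 0 → γ' ≠ γ → g.coeff γ' ≠ 0 → γ < γ' := by
    intro γ' h0 h1 h2
    refine lt_of_le_of_ne (order_le_of_coeff_ne_zero ?_) (Ne.symm h1)
    rwa [hrc γ' h0]
  obtain ⟨k, hk, hlt⟩ := exists_first_ne hγ0
  obtain ⟨S, hS, hsum⟩ := hg
  obtain ⟨T, hT, hTsum⟩ := exists_summableFamily_of_support_subset LinearMap.id
    (Set.isPWO_singleton 0) (fun h => by simp) g
  have hzero : (S - T).hsum = 0 := by
    rw [SummableFamily.hsum_sub, hsum, hTsum, LinearMap.id_apply, sub_self]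
  have hterm : ∀ γ', (S - T) γ' = C (g.coeff γ') * (monoComp f γ' - single γ' 1) := by
    intro γ'
    rw [SummableFamily.sub_apply, hS, hT, LinearMap.id_apply, mul_sub]
  -- only the monomial `γ` contributes to the coefficient at the leading exponent of its displacement
  have hcoef := congrArg (fun s => s.coeff (γ + (e + ellProdExpo k))) hzero
  simp only [SummableFamily.coeff_hsum, coeff_zero] at hcoef
  rw [finsum_eq_single _ γ] at hcoef
  · rw [hterm, C_mul_eq_smul, HahnSeries.coeff_smul, (leads_monoComp_sub h he hk hlt).1,
      smul_eq_mul, ← hrc γ hγ0] at hcoef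
    exact mul_ne_zero hγr (mul_ne_zero hk hc) hcoef
  · intro γ' hγ'
    rw [hterm, C_mul_eq_smul, HahnSeries.coeff_smul, smul_eq_mul]
    by_cases h0 : γ' = 0
    · rw [h0, monoComp_zero]; simp
    by_cases h1 : g.coeff γ' = 0
    · rw [h1, zero_mul]
    obtain ⟨k', hk', hlt'⟩ := exists_first_ne h0
    have h2 := add_ellProdExpo_lt hk hlt hk' hlt' (hmin γ' h0 hγ' h1)
    rw [(leads_monoComp_sub h he hk' hlt').2, mul_zero]
    rw [show γ + (e + ellProdExpo k) = e + (γ + ellProdExpo k) by abel,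
      show γ' + (e + ellProdExpo k') = e + (γ' + ellProdExpo k') by abel]
    exact add_lt_add_right h2 e

theorem IsComp.sub {f g g' h h' : Transseries} (H : IsComp g f h) (H' : IsComp g' f h') :
    IsComp (g - g') f (h - h') := by
  obtain ⟨S, hS, hsum⟩ := H
  obtain ⟨S', hS', hsum'⟩ := H'
  refine ⟨S - S', fun γ => ?_, by rw [SummableFamily.hsum_sub, hsum, hsum']⟩
  rw [SummableFamily.sub_apply, hS, hS']
  simp only [coeff_sub, map_sub, sub_mul]

/-! ### The derivation `x d/dx` -/

/-- The Euler operator: the monomial with exponent `γ` is multiplied by `γ_i`. -/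
def euler (i : ℕ) : Transseries →ₗ[ℝ] Transseries where
  toFun h :=
    { coeff := fun γ => ofLex γ i * h.coeff γ
      isPWO_support' := h.isPWO_support.mono fun _ hγ => right_ne_zero_of_mul hγ }
  map_add' g h := by ext γ; simp [mul_add]
  map_smul' r h := by ext γ; simp; ring

@[simp]
theorem coeff_euler (i : ℕ) (h : Transseries) (γ : Expo) :
    (euler i h).coeff γ = ofLex γ i * h.coeff γ := rfl

theorem support_euler_subset (i : ℕ) (h : Transseries) : (euler i h).support ⊆ h.support :=
  fun _ hγ => right_ne_zero_of_mul hγ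

theorem euler_mul (i : ℕ) (g h : Transseries) :
    euler i (g * h) = euler i g * h + g * euler i h := by
  ext γ
  rw [coeff_euler, coeff_add, coeff_mul, coeff_mul_left' g.isPWO_support (support_euler_subset i g),
    coeff_mul_right' h.isPWO_support (support_euler_subset i h), ← Finset.sum_add_distrib,
    Finset.mul_sum]
  refine Finset.sum_congr rfl fun p hp => ?_
  rw [Finset.mem_antidiagonal] at hp
  rw [coeff_euler, coeff_euler, ← hp.2.2, ofLex_add_apply]
  ring

theorem euler_single (i : ℕ) (γ : Expo) (r : ℝ) :
    euler i (single γ r) = single γ (ofLex γ i * r) := by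
  ext γ'
  rw [coeff_euler]
  by_cases h : γ' = γ
  · subst h; rw [coeff_single_same, coeff_single_same]
  · rw [coeff_single_of_ne h, coeff_single_of_ne h, mul_zero]

theorem ellPow_add (k : ℕ) (a b : ℝ) : ellPow k (a + b) = ellPow k a * ellPow k b := by
  rw [ellPow, ellPow, ellPow, single_mul_single, expo_add, one_mul]

theorem ellPow_zero (k : ℕ) : ellPow k 0 = 1 := by
  rw [ellPow, expo_zero]; rfl

theorem map_C_mul (L : Transseries →ₗ[ℝ] Transseries) (r : ℝ) (h : Transseries) :
    L (C r * h) = C r * L h := by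
  rw [C_mul_eq_smul, C_mul_eq_smul]; exact L.map_smul r h

theorem single_eq_C_mul (γ : Expo) (r : ℝ) : (single γ r : Transseries) = C r * single γ 1 := by
  rw [C_apply, single_mul_single, zero_add, mul_one]

/-- Multiplication by a fixed transseries, as a linear map. -/
def mulOp (g : Transseries) : Transseries →ₗ[ℝ] Transseries where
  toFun h := g * h
  map_add' := mul_add g
  map_smul' r h := by
    rw [RingHom.id_apply, ← C_mul_eq_smul, ← C_mul_eq_smul]; ring

/-- The derivation `x d/dx` on transseries in `x, ℓ₁, ℓ₂` (the further iterated logarithms are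
treated as constants). -/
def eulerD : Module.End ℝ Transseries :=
  euler 0 + mulOp (ellPow 1 1) ∘ₗ euler 1 +
    mulOp (ellPow 1 1 * ellPow 2 1) ∘ₗ euler 2

theorem eulerD_apply (h : Transseries) :
    eulerD h = euler 0 h + ellPow 1 1 * euler 1 h + ellPow 1 1 * ellPow 2 1 * euler 2 h := rfl

theorem eulerD_mul (g h : Transseries) : eulerD (g * h) = eulerD g * h + g * eulerD h := by
  simp only [eulerD_apply, euler_mul]; ring

theorem eulerD_single (γ : Expo) (r : ℝ) :
    eulerD (single γ r) = single γ (ofLex γ 0 * r) + ellPow 1 1 * single γ (ofLex γ 1 * r) +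
      ellPow 1 1 * ellPow 2 1 * single γ (ofLex γ 2 * r) := by
  simp only [eulerD_apply, euler_single]

theorem eulerD_ellPow_zero (a : ℝ) : eulerD (ellPow 0 a) = C a * ellPow 0 a := by
  rw [ellPow, eulerD_single, ← single_eq_C_mul]
  simp [expo_apply]

theorem eulerD_ellPow_one (a : ℝ) : eulerD (ellPow 1 a) = C a * ellPow 1 (a + 1) := by
  rw [add_comm a 1, ellPow_add, mul_left_comm]
  rw [ellPow, ellPow, eulerD_single, ← single_eq_C_mul]
  simp [expo_apply, ellPow]

/-- `ℓ₂⁻¹ = log (-log x)` is an antiderivative of `-x⁻¹ * ℓ₁`. -/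
theorem eulerD_ellPow_two : eulerD (ellPow 2 (-1)) = - ellPow 1 1 := by
  have h : ellPow 2 1 * ellPow 2 (-1) = 1 := by
    rw [← ellPow_add, add_neg_cancel, ellPow_zero]
  have h2 : euler 2 (ellPow 2 (-1)) = - ellPow 2 (-1) := by
    rw [ellPow, euler_single]; simp [expo_apply]
  have h0 : ∀ i ≠ 2, euler i (ellPow 2 (-1)) = 0 := by
    intro i hi
    rw [ellPow, euler_single, expo_apply, if_neg hi.symm, zero_mul, single_eq_zero]
  rw [eulerD_apply, h0 0 (by omega), h0 1 (by omega), h2]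
  linear_combination (- ellPow 1 1) * h

/-- The exponents by which `x d/dx` moves supports. -/
def eulerExpo : AddSubmonoid Expo := AddSubmonoid.closure {expo 1 1, expo 1 1 + expo 2 1}

theorem eulerExpo_isPWO : (eulerExpo : Set Expo).IsPWO := by
  refine Set.IsPWO.addSubmonoid_closure ?_ ?_
  · rintro γ (rfl | rfl)
    · exact (expo_pos 1 one_pos).le
    · exact (add_pos (expo_pos 1 one_pos) (expo_pos 2 one_pos)).le
  · exact (Set.toFinite _).isPWO

theorem support_eulerD_subset (h : Transseries) :
    (eulerD h).support ⊆ h.support + (eulerExpo : Set Expo) := by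
  intro γ hγ
  rw [eulerD_apply] at hγ
  have key : ∀ (δ : Expo) (i : ℕ), δ ∈ eulerExpo → γ ∈ (single δ (1 : ℝ) * euler i h).support →
      γ ∈ h.support + (eulerExpo : Set Expo) := by
    intro δ i hδ hmem
    obtain ⟨a, ha, b, hb, rfl⟩ := support_mul_subset hmem
    have : a = δ := by
      by_contra hne
      exact ha (coeff_single_of_ne hne)
    subst this
    refine ⟨b, ?_, a, ?_, add_comm b a⟩
    · exact support_euler_subset i h hb
    · exact hδ
  rcases support_add_subset _ _ hγ with h1 | h1
  · rcases support_add_subset _ _ h1 with h2 | h2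
    · exact ⟨γ, support_euler_subset 0 h h2, 0, zero_mem _, add_zero γ⟩
    · exact key _ 1 (AddSubmonoid.subset_closure (by simp)) h2
  · refine key (expo 1 1 + expo 2 1) 2 (AddSubmonoid.subset_closure (by simp)) ?_
    rwa [ellPow, ellPow, single_mul_single, one_mul] at h1

theorem support_eulerD_pow_subset (k : ℕ) (h : Transseries) :
    ((eulerD ^ k) h).support ⊆ h.support + (eulerExpo : Set Expo) := by
  induction k with
  | zero => intro γ hγ; exact ⟨γ, hγ, 0, zero_mem _, add_zero γ⟩
  | succ k ih =>
    intro γ hγ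
    rw [pow_succ', Module.End.mul_apply] at hγ
    obtain ⟨a, ha, b, hb, rfl⟩ := support_eulerD_subset _ hγ
    obtain ⟨a', ha', b', hb', rfl⟩ := ih ha
    exact ⟨a', ha', b' + b, add_mem hb' hb, (add_assoc _ _ _).symm⟩

/-! ### Operators of infinite order and Taylor's formula -/

/-- The family `k ↦ c k * τ ^ k * (x d/dx) ^ k h`. -/
def taylorFamily (c : ℕ → ℝ) (τ h : Transseries) : SummableFamily Expo ℝ ℕ :=
  mulBounded (SummableFamily.smulFamily c (SummableFamily.powers τ)) (fun k => (eulerD ^ k) h)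
    (h.isPWO_support.add eulerExpo_isPWO) fun k => support_eulerD_pow_subset k h

theorem taylorFamily_apply {c : ℕ → ℝ} {τ h : Transseries} (hτ : 0 < τ.orderTop) (k : ℕ) :
    taylorFamily c τ h k = C (c k) * τ ^ k * (eulerD ^ k) h := by
  rw [taylorFamily, mulBounded_apply, SummableFamily.smulFamily_toFun,
    SummableFamily.powers_of_orderTop_pos hτ, C_mul_eq_smul]

/-- The operator `h ↦ ∑ c k * τ ^ k * (x d/dx) ^ k h`, for an infinitesimal `τ`. With
`c k = 1 / k!` it is the substitution `x ↦ x * exp τ`. -/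
def taylorOp (c : ℕ → ℝ) (τ : Transseries) : Transseries →ₗ[ℝ] Transseries where
  toFun h := (taylorFamily c τ h).hsum
  map_add' g h := by
    rw [← SummableFamily.hsum_add]
    congr 1
    ext1 k
    simp only [taylorFamily, mulBounded_apply, SummableFamily.add_apply, map_add, mul_add]
  map_smul' r h := by
    rw [RingHom.id_apply, ← C_mul_eq_smul, ← C_mul_eq_smul, ← SummableFamily.hsum_smul]
    congr 1
    ext1 k
    rw [SummableFamily.smul_apply, of_symm_smul_of_eq_mul]
    simp only [taylorFamily, mulBounded_apply, map_C_mul]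
    ring

theorem taylorOp_apply (c : ℕ → ℝ) (τ h : Transseries) :
    taylorOp c τ h = (taylorFamily c τ h).hsum := rfl

/-- The recursion that separates the term `k = 0` from an operator of infinite order. -/
theorem taylorOp_shift (c : ℕ → ℝ) {τ : Transseries} (hτ : 0 < τ.orderTop) (h : Transseries) :
    taylorOp c τ h = C (c 0) * h + τ * taylorOp (fun k => c (k + 1)) τ (eulerD h) := by
  rw [taylorOp_apply, taylorOp_apply, ← SummableFamily.hsum_smul,
    hsum_eq_zero_add (t := τ • taylorFamily (fun k => c (k + 1)) τ (eulerD h))]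
  · rw [taylorFamily_apply hτ]; simp
  · intro n
    rw [SummableFamily.smul_apply, of_symm_smul_of_eq_mul, taylorFamily_apply hτ,
      taylorFamily_apply hτ, pow_succ eulerD, Module.End.mul_apply, pow_succ τ]
    ring

theorem support_taylorOp_subset (c : ℕ → ℝ) {τ : Transseries} (hτ : 0 < τ.orderTop)
    (h : Transseries) : (taylorOp c τ h).support ⊆
      h.support + ((AddSubmonoid.closure τ.support : Set Expo) + (eulerExpo : Set Expo)) := by
  rw [taylorOp_apply]
  refine SummableFamily.support_hsum_subset.trans (Set.iUnion_subset fun k => ?_)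
  rw [taylorFamily_apply hτ]
  intro γ hγ
  obtain ⟨a, ha, b, hb, rfl⟩ := support_mul_subset hγ
  obtain ⟨b', hb', d, hd, rfl⟩ := support_eulerD_pow_subset k h hb
  refine ⟨b', hb', a + d, ⟨a, ?_, d, hd, rfl⟩, ?_⟩
  · refine SummableFamily.support_pow_subset_closure τ k ?_
    rw [C_mul_eq_smul, mem_support, HahnSeries.coeff_smul] at ha
    exact right_ne_zero_of_smul ha
  · simp only; abel

theorem support_nonneg_of_orderTop_pos {τ : Transseries} (hτ : 0 < τ.orderTop) :
    ∀ γ ∈ τ.support, 0 ≤ γ := by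
  intro γ hγ
  have h1 : τ ≠ 0 := by rintro rfl; exact hγ rfl
  exact ((zero_lt_orderTop_iff h1).1 hτ).le.trans (order_le_of_coeff_ne_zero hγ)

theorem taylor_support_isPWO {τ : Transseries} (hτ : 0 < τ.orderTop) :
    ((AddSubmonoid.closure τ.support : Set Expo) + (eulerExpo : Set Expo)).IsPWO :=
  (τ.isPWO_support.addSubmonoid_closure (support_nonneg_of_orderTop_pos hτ)).add eulerExpo_isPWO

/-- The coefficients of the exponential series. -/
def expCoeff (k : ℕ) : ℝ := (k.factorial : ℝ)⁻¹

theorem expCoeff_zero : expCoeff 0 = 1 := by simp [expCoeff]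

theorem expCoeff_succ (k : ℕ) : expCoeff (k + 1) * (k + 1) = expCoeff k := by
  simp only [expCoeff, Nat.factorial_succ]
  push_cast
  field_simp

theorem eulerD_pow_ellInv_mul (g : Transseries) (k : ℕ) :
    (eulerD ^ (k + 1)) (ellPow 1 (-1) * g) =
      ellPow 1 (-1) * (eulerD ^ (k + 1)) g - C ((k : ℝ) + 1) * (eulerD ^ k) g := by
  have h1 : eulerD (ellPow 1 (-1)) = -1 := by
    rw [eulerD_ellPow_one, neg_add_cancel, ellPow_zero, map_neg, map_one, mul_one]
  induction k with
  | zero =>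
    rw [zero_add, pow_one, eulerD_mul, h1]
    simp
    ring
  | succ k ih =>
    rw [pow_succ', Module.End.mul_apply, ih, map_sub, eulerD_mul, h1, map_C_mul,
      ← Module.End.mul_apply, ← pow_succ', ← Module.End.mul_apply, ← pow_succ']
    push_cast
    simp only [map_add, map_one]
    ring

/-- The substitution `x ↦ x * exp τ` sends `ℓ₁⁻¹ = -log x` to `ℓ₁⁻¹ - τ`, and it is
multiplicative as far as this factor is concerned. -/
theorem taylor_ellInv_mul {τ : Transseries} (hτ : 0 < τ.orderTop) (g : Transseries) :
    taylorOp expCoeff τ (ellPow 1 (-1) * g) = (ellPow 1 (-1) - τ) * taylorOp expCoeff τ g := by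
  have hfam : taylorFamily expCoeff τ (ellPow 1 (-1) * g) =
      ellPow 1 (-1) • taylorFamily expCoeff τ g -
        (τ • taylorFamily expCoeff τ g).embDomain ⟨Nat.succ, Nat.succ_injective⟩ := by
    ext1 n
    rw [SummableFamily.sub_apply, SummableFamily.smul_apply, of_symm_smul_of_eq_mul]
    cases n with
    | zero =>
      have := SummableFamily.embDomain_of_notMem_range (s := τ • taylorFamily expCoeff τ g)
        (f := ⟨Nat.succ, Nat.succ_injective⟩) (b := 0) (by simp)
      rw [this, taylorFamily_apply hτ, taylorFamily_apply hτ]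
      simp only [pow_zero, Module.End.one_apply, mul_one, sub_zero]
      ring
    | succ n =>
      have := SummableFamily.embDomain_image (s := τ • taylorFamily expCoeff τ g)
        (f := ⟨Nat.succ, Nat.succ_injective⟩) (a := n)
      simp only [Function.Embedding.coeFn_mk, Nat.succ_eq_add_one] at this
      rw [this, SummableFamily.smul_apply, of_symm_smul_of_eq_mul, taylorFamily_apply hτ,
        taylorFamily_apply hτ, taylorFamily_apply hτ, eulerD_pow_ellInv_mul, ← expCoeff_succ n,
        pow_succ τ]
      simp only [map_mul, map_add, map_one]
      ring
  rw [taylorOp_apply, taylorOp_apply, hfam, SummableFamily.hsum_sub, SummableFamily.hsum_embDomain,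
    SummableFamily.hsum_smul, SummableFamily.hsum_smul, sub_mul]

/-- `x ^ a` is sent to `x ^ a * exp (a * τ)`. -/
theorem taylor_ellPow_zero {τ : Transseries} (hτ : 0 < τ.orderTop) (a : ℝ) :
    taylorOp expCoeff τ (ellPow 0 a) = ellPow 0 a * PowerSeries.heval τ (expSeries a) := by
  have hpow : ∀ k : ℕ, (eulerD ^ k) (ellPow 0 a) = C (a ^ k) * ellPow 0 a := by
    intro k
    induction k with
    | zero => simp
    | succ k ih =>
      rw [pow_succ', Module.End.mul_apply, ih, map_C_mul, eulerD_ellPow_zero, ← mul_assoc, ← map_mul,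
        pow_succ]
  rw [taylorOp_apply, PowerSeries.heval_apply, ← SummableFamily.hsum_smul]
  congr 1
  ext1 k
  rw [SummableFamily.smul_apply, of_symm_smul_of_eq_mul, taylorFamily_apply hτ, hpow,
    SummableFamily.powerSeriesFamily_of_orderTop_pos hτ, expSeries, PowerSeries.coeff_mk]
  simp only [← C_mul_eq_smul, map_mul, expCoeff]
  ring

/-- `ℓ₂⁻¹` is sent to `ℓ₂⁻¹ + log (1 - ℓ₁ * τ)`. -/
theorem taylor_ellPow_two {τ : Transseries} (hτ : 0 < τ.orderTop)
    (hτ1 : 0 < (ellPow 1 1 * τ).orderTop) :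
    taylorOp expCoeff τ (ellPow 2 (-1)) =
      ellPow 2 (-1) - ellPow 1 1 * τ * PowerSeries.heval (ellPow 1 1 * τ) logQuot := by
  have hpow : ∀ k : ℕ, (eulerD ^ k) (ellPow 1 1) = C (k.factorial : ℝ) * ellPow 1 1 ^ (k + 1) := by
    have hp : ∀ k : ℕ, ellPow 1 1 ^ k = ellPow 1 (k : ℝ) := by
      intro k
      induction k with
      | zero => simp [ellPow_zero]
      | succ k ih => rw [pow_succ, ih, ← ellPow_add]; push_cast; rfl
    intro k
    induction k with
    | zero => simp
    | succ k ih =>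
      rw [pow_succ', Module.End.mul_apply, ih, map_C_mul, hp, eulerD_ellPow_one, hp, ← mul_assoc,
        ← map_mul, Nat.factorial_succ]
      push_cast
      rw [mul_comm ((k : ℝ) + 1)]
  have hW : taylorOp (fun k => expCoeff (k + 1)) τ (ellPow 1 1) =
      ellPow 1 1 * PowerSeries.heval (ellPow 1 1 * τ) logQuot := by
    rw [taylorOp_apply, PowerSeries.heval_apply, ← SummableFamily.hsum_smul]
    congr 1
    ext1 k
    rw [SummableFamily.smul_apply, of_symm_smul_of_eq_mul, taylorFamily_apply hτ, hpow,
      SummableFamily.powerSeriesFamily_of_orderTop_pos hτ1, logQuot, PowerSeries.coeff_mk]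
    have hc : ((k : ℝ) + 1)⁻¹ = expCoeff (k + 1) * k.factorial := by
      simp only [expCoeff, Nat.factorial_succ]
      push_cast
      have : (k.factorial : ℝ) ≠ 0 := by positivity
      field_simp
    rw [hc]
    simp only [← C_mul_eq_smul, map_mul]
    ring
  rw [taylorOp_shift _ hτ, expCoeff_zero, map_one, one_mul, eulerD_ellPow_two, map_neg, hW]
  ring

/-! ### Composition of monomials is given by Taylor's formula -/

theorem realPow_zero (u : Transseries) : realPow u 0 = 1 := by
  rw [realPow, PowerSeries.binomialSeries_zero, map_one]

theorem realPow_add (u : Transseries) (a b : ℝ) :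
    realPow u (a + b) = realPow u a * realPow u b := by
  rw [realPow, PowerSeries.binomialSeries_add, map_mul]; rfl

theorem realPow_one {u : Transseries} (hu : 0 < (u - 1).orderTop) : realPow u 1 = u := by
  have : PowerSeries.binomialSeries ℝ (1 : ℝ) = (1 + PowerSeries.X : PowerSeries ℝ) := by
    simpa using PowerSeries.binomialSeries_nat (R := ℝ) (A := ℝ) 1
  rw [realPow, this, map_add, map_one, PowerSeries.heval_X _ hu]
  ring

theorem realPow_intCast {u : Transseries} (hu : 0 < (u - 1).orderTop) (n : ℤ) :
    realPow u n = u ^ n := by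
  have h1 : realPow u (-1) * u = 1 := by
    have := realPow_add u (-1) 1
    rwa [neg_add_cancel, realPow_zero, realPow_one hu, eq_comm] at this
  have hu0 : u ≠ 0 := right_ne_zero_of_mul_eq_one h1
  induction n using Int.induction_on with
  | zero => simp [realPow_zero]
  | succ n ih =>
    push_cast at ih ⊢
    rw [realPow_add, ih, realPow_one hu, zpow_add_one₀ hu0]
  | pred n ih =>
    push_cast at ih ⊢
    rw [sub_eq_add_neg, realPow_add, ih, zpow_sub_one₀ hu0, eq_inv_of_mul_eq_one_left h1]

/-- `u ^ a = exp (a * log u)`. -/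
theorem realPow_eq_heval_formalLog {u : Transseries} (hu : 0 < (u - 1).orderTop)
    (hl : 0 < (formalLog u).orderTop) (a : ℝ) :
    realPow u a = PowerSeries.heval (formalLog u) (expSeries a) := by
  rw [realPow, ← expSeries_subst_log, heval_subst _ hu _ _ PowerSeries.constantCoeff_log hl]
  rfl

/-- A factor `ℓ₁ ^ n` is sent to `(ℓ₁ / (1 - ℓ₁ * τ)) ^ n`, for integer `n`. -/
theorem taylor_ellPow_one_mul {τ : Transseries} (hτ : 0 < τ.orderTop)
    (hv : 1 - ellPow 1 1 * τ ≠ 0) (n : ℤ) (g : Transseries) :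
    taylorOp expCoeff τ (ellPow 1 n * g) =
      ellPow 1 n * ((1 - ellPow 1 1 * τ)⁻¹) ^ n * taylorOp expCoeff τ g := by
  set u := (1 - ellPow 1 1 * τ)⁻¹ with hu
  have hu0 : u ≠ 0 := inv_ne_zero hv
  have huv : u * (1 - ellPow 1 1 * τ) = 1 := inv_mul_cancel₀ hv
  have hl : ellPow 1 (-1) * ellPow 1 1 = 1 := by
    rw [← ellPow_add, neg_add_cancel, ellPow_zero]
  induction n using Int.induction_on with
  | zero => simp [ellPow_zero]
  | succ n ih =>
    have h1 := taylor_ellInv_mul hτ (ellPow 1 ((n : ℝ) + 1) * g)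
    rw [← mul_assoc, ← ellPow_add, show (-1 : ℝ) + (n + 1) = n by ring] at h1
    push_cast at ih ⊢
    rw [ih] at h1
    rw [zpow_add_one₀ hu0, ellPow_add]
    rw [ellPow_add] at h1
    have h3 : (ellPow 1 (-1) - τ) * (ellPow 1 1 * u) = 1 := by
      linear_combination (u) * hl + huv
    linear_combination (-ellPow 1 1 * u) * h1 -
      taylorOp expCoeff τ (ellPow 1 ↑n * ellPow 1 1 * g) * h3
  | pred n ih =>
    have h1 := taylor_ellInv_mul hτ (ellPow 1 (-(n : ℝ)) * g)
    rw [← mul_assoc, ← ellPow_add] at h1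
    have hui : u⁻¹ = 1 - ellPow 1 1 * τ := inv_inv _
    push_cast at ih ⊢
    rw [show -(n : ℝ) - 1 = -1 + -n by ring, h1, ih, zpow_sub_one₀ hu0, hui, ellPow_add]
    linear_combination (τ * ellPow 1 (-↑n) * u ^ (-(n : ℤ)) * (taylorOp expCoeff τ) g) * hl

theorem monoComp_eq_of_support {f : Transseries} {γ : Expo} (h : ∀ i, 3 ≤ i → ofLex γ i = 0) :
    monoComp f γ = single γ 1 * (realPow (ellFactor f 0) (ofLex γ 0) *
      realPow (ellFactor f 1) (ofLex γ 1) * realPow (ellFactor f 2) (ofLex γ 2)) := by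
  have hsub : (ofLex γ).support ⊆ Finset.range 3 := by
    intro i hi
    rw [Finset.mem_range]
    by_contra hcon
    exact (Finsupp.mem_support_iff.1 hi) (h i (not_lt.1 hcon))
  rw [monoComp, Finset.prod_subset hsub]
  · rw [Finset.prod_range_succ, Finset.prod_range_succ, Finset.prod_range_one]
  · intro i _ hi
    rw [Finsupp.notMem_support_iff.1 hi, realPow_zero]

section

variable {f : Transseries} {e : Expo} {c : ℝ}

theorem ellFactor_orderTop_pos (h : Leads (ellPow 0 (-1) * f - 1) e c) (he : 0 < e) (k : ℕ) :
    0 < (ellFactor f k - 1).orderTop ∧ 0 < (formalLog (ellFactor f k)).orderTop ∧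
      0 < (ellPow (k + 1) 1 * formalLog (ellFactor f k)).orderTop := by
  have hpos := add_pos_of_pos_of_nonneg he (ellProdExpo_nonneg k)
  have h1 := leads_ellFactor h he k
  refine ⟨h1.orderTop_pos hpos, (h1.formalLog hpos).orderTop_pos hpos, ?_⟩
  exact ((leads_single (expo (k + 1) 1) (1 : ℝ)).mul (h1.formalLog hpos)).orderTop_pos
    (add_pos (expo_pos _ one_pos) hpos)

theorem one_sub_ne_zero_of_orderTop_pos {x : Transseries} (hx : 0 < x.orderTop) : 1 - x ≠ 0 := by
  intro h0
  rw [← sub_eq_zero.1 h0, orderTop_one] at hx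
  exact lt_irrefl _ hx

/-- On a monomial `x ^ a * ℓ ^ n` with integer `n`, composition is Taylor's formula. -/
theorem taylor_single_eq_monoComp (h : Leads (ellPow 0 (-1) * f - 1) e c) (he : 0 < e)
    (a : ℝ) (n : ℤ) :
    taylorOp expCoeff (formalLog (ellFactor f 0)) (single (expo 0 a + expo 1 (n : ℝ)) 1) =
      monoComp f (expo 0 a + expo 1 (n : ℝ)) := by
  obtain ⟨h0, h1, h2⟩ := ellFactor_orderTop_pos h he 0
  obtain ⟨h3, -, -⟩ := ellFactor_orderTop_pos h he 1
  rw [monoComp_eq_of_support]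
  · simp only [ofLex_add_apply, expo_apply, if_pos, if_neg one_ne_zero, if_neg zero_ne_one, add_zero,
      zero_add]
    rw [if_neg (by omega), if_neg (by omega), add_zero, realPow_zero, mul_one,
      realPow_intCast h3, realPow_eq_heval_formalLog h0 h1]
    have hs : (single (expo 0 a + expo 1 (n : ℝ)) 1 : Transseries) = ellPow 1 n * ellPow 0 a := by
      rw [ellPow, ellPow, single_mul_single, one_mul, add_comm]
    rw [hs, taylor_ellPow_one_mul h1 (one_sub_ne_zero_of_orderTop_pos h2), taylor_ellPow_zero h1]
    rw [show ellFactor f 1 = (1 - ellPow 1 1 * formalLog (ellFactor f 0))⁻¹ from rfl]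
    ring
  · intro i hi
    rw [ofLex_add_apply, expo_apply, expo_apply, if_neg (by omega), if_neg (by omega), add_zero]

theorem taylor_ellPow_two_eq_monoComp (h : Leads (ellPow 0 (-1) * f - 1) e c) (he : 0 < e) :
    taylorOp expCoeff (formalLog (ellFactor f 0)) (ellPow 2 (-1)) = monoComp f (expo 2 (-1)) := by
  obtain ⟨h0, h1, h2⟩ := ellFactor_orderTop_pos h he 0
  obtain ⟨h3, h4, h5⟩ := ellFactor_orderTop_pos h he 1
  obtain ⟨h6, -, -⟩ := ellFactor_orderTop_pos h he 2
  rw [monoComp_eq_of_support]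
  · simp only [expo_apply, if_pos]
    rw [if_neg (by omega), if_neg (by omega), realPow_zero, realPow_zero, one_mul, one_mul,
      taylor_ellPow_two h1 h2]
    have hr := realPow_intCast h6 (-1)
    push_cast at hr
    rw [hr, show ellFactor f 2 = (1 - ellPow 2 1 * formalLog (ellFactor f 1))⁻¹ from rfl,
      zpow_neg_one, inv_inv]
    set y := ellPow 1 1 * formalLog (ellFactor f 0) with hy
    have hgeom : ellFactor f 1 = PowerSeries.heval y geom := by
      have h7 : PowerSeries.heval y geom * (1 - y) = 1 := by
        have := congrArg (PowerSeries.heval y) geom_mul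
        rwa [map_mul, map_sub, map_one, PowerSeries.heval_X _ h2] at this
      exact (eq_inv_of_mul_eq_one_left h7).symm
    have hg1 : ellFactor f 1 - 1 = PowerSeries.heval y (geom - 1) := by
      rw [map_sub, map_one, hgeom]
    have hlog : formalLog (ellFactor f 1) = y * PowerSeries.heval y logQuot := by
      rw [formalLog, hg1, ← heval_subst y h2 _ _ _ (hg1 ▸ h3), log_subst_geom, map_mul,
        PowerSeries.heval_X _ h2]
      rw [← PowerSeries.coeff_zero_eq_constantCoeff_apply, map_sub]; simp [geom]
    have hl : ellPow 2 (-1) * ellPow 2 1 = 1 := by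
      rw [← ellPow_add, neg_add_cancel, ellPow_zero]
    rw [hlog, ← ellPow]
    linear_combination (y * PowerSeries.heval y logQuot) * hl
  · intro i hi
    rw [expo_apply, if_neg (by omega)]

/-- Composition with `f` is Taylor's formula on every transseries all of whose monomials are
`ℓ₂⁻¹` or of the form `x ^ a * ℓ ^ n` with integer `n`. -/
theorem isComp_taylorOp (h : Leads (ellPow 0 (-1) * f - 1) e c) (he : 0 < e) (g : Transseries)
    (hg : ∀ γ ∈ g.support, γ = expo 2 (-1) ∨ ∃ (a : ℝ) (n : ℤ), γ = expo 0 a + expo 1 (n : ℝ)) :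
    IsComp g f (taylorOp expCoeff (formalLog (ellFactor f 0)) g) := by
  obtain ⟨h0, h1, h2⟩ := ellFactor_orderTop_pos h he 0
  obtain ⟨F, hF, hsum⟩ := exists_summableFamily_of_support_subset
    (taylorOp expCoeff (formalLog (ellFactor f 0))) (taylor_support_isPWO h1)
    (support_taylorOp_subset expCoeff h1) g
  refine ⟨F, fun γ => ?_, hsum⟩
  rw [hF]
  by_cases hγ : g.coeff γ = 0
  · simp only [hγ, map_zero, zero_mul]
  · congr 1
    rcases hg γ hγ with rfl | ⟨a, n, rfl⟩
    · exact taylor_ellPow_two_eq_monoComp h he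
    · exact taylor_single_eq_monoComp h he a n

end

/-! ### Laurent series in `ℓ` -/

/-- The exponent of `x ^ a * ℓ ^ n`. -/
def xlExpo (a : ℝ) (n : ℤ) : Expo := expo 0 a + expo 1 (n : ℝ)

theorem xlExpo_apply_zero (a : ℝ) (n : ℤ) : ofLex (xlExpo a n) 0 = a := by
  rw [xlExpo, ofLex_add_apply, expo_apply, expo_apply, if_pos rfl, if_neg one_ne_zero, add_zero]

theorem xlExpo_apply_one (a : ℝ) (n : ℤ) : ofLex (xlExpo a n) 1 = n := by
  rw [xlExpo, ofLex_add_apply, expo_apply, expo_apply, if_pos rfl, if_neg zero_ne_one, zero_add]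

theorem xlExpo_apply_of_two_le (a : ℝ) (n : ℤ) {i : ℕ} (hi : 2 ≤ i) : ofLex (xlExpo a n) i = 0 := by
  rw [xlExpo, ofLex_add_apply, expo_apply, expo_apply, if_neg (by omega), if_neg (by omega),
    add_zero]

theorem xlExpo_inj {a b : ℝ} {m n : ℤ} : xlExpo a m = xlExpo b n ↔ a = b ∧ m = n := by
  refine ⟨fun h => ⟨?_, ?_⟩, fun h => by rw [h.1, h.2]⟩
  · rw [← xlExpo_apply_zero a m, h, xlExpo_apply_zero]
  · have : (m : ℝ) = n := by rw [← xlExpo_apply_one a m, h, xlExpo_apply_one]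
    exact_mod_cast this

theorem xlExpo_add (a b : ℝ) (m n : ℤ) : xlExpo a m + xlExpo b n = xlExpo (a + b) (m + n) := by
  simp only [xlExpo, expo_add, Int.cast_add]; abel

theorem xlExpo_lt_iff (a : ℝ) {m n : ℤ} : xlExpo a m < xlExpo a n ↔ m < n := by
  have h : ∀ n : ℤ, expo 1 (n : ℝ) = ellExpo n := fun _ => rfl
  rw [xlExpo, xlExpo, add_lt_add_iff_left, h, h, ellExpo.lt_iff_lt]

theorem block_apply (a : ℝ) (F : LaurentSeries ℝ) :
    block a F = single (expo 0 a) 1 * embDomain ellExpo F := rfl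

theorem coeff_block_xlExpo (a b : ℝ) (n : ℤ) (F : LaurentSeries ℝ) :
    (block a F).coeff (xlExpo b n) = if a = b then F.coeff n else 0 := by
  rw [block_apply, coeff_single_mul, one_mul]
  split_ifs with h
  · subst h
    rw [show xlExpo a n - expo 0 a = ellExpo n from add_sub_cancel_left _ _, embDomain_coeff]
  · refine embDomain_of_notMem_range ?_
    rintro ⟨m, hm⟩
    have h2 : xlExpo b n = xlExpo a m := by
      exact sub_eq_iff_eq_add'.1 hm.symm
    exact h (xlExpo_inj.1 h2).1.symm

theorem support_block {a : ℝ} {F : LaurentSeries ℝ} {γ : Expo} (h : γ ∈ (block a F).support) :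
    ∃ n : ℤ, γ = xlExpo a n ∧ F.coeff n ≠ 0 := by
  have h1 := h
  rw [block_apply, mem_support, coeff_single_mul, one_mul] at h1
  have hr : γ - expo 0 a ∈ Set.range ellExpo := by
    by_contra hcon
    exact h1 (embDomain_of_notMem_range hcon)
  obtain ⟨n, hn⟩ := hr
  have h2 : γ = xlExpo a n := by
    exact sub_eq_iff_eq_add'.1 hn.symm
  refine ⟨n, h2, ?_⟩
  rw [mem_support, h2, coeff_block_xlExpo, if_pos rfl] at h
  exact h

theorem block_add (a : ℝ) (F G : LaurentSeries ℝ) : block a (F + G) = block a F + block a G := by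
  rw [block, block, block, embDomain_add, mul_add]

theorem block_zero (a : ℝ) : block a 0 = 0 := by
  rw [block, embDomain_zero, mul_zero]

theorem block_mul (a b : ℝ) (F G : LaurentSeries ℝ) :
    block a F * block b G = block (a + b) (F * G) := by
  have h : embDomain ellExpo (F * G) = embDomain ellExpo F * embDomain ellExpo G := by
    refine embDomain_mul ellExpo (fun m n => ?_) F G
    change expo 1 ((m + n : ℤ) : ℝ) = expo 1 (m : ℝ) + expo 1 (n : ℝ)
    rw [Int.cast_add, expo_add]
  rw [block, block, block, h, ellPow_add]
  ring

theorem block_C (a r : ℝ) : block a (C r) = C r * ellPow 0 a := by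
  have h : embDomain ellExpo (C r : LaurentSeries ℝ) = C r := by
    have h0 : ellExpo 0 = 0 := by
      change expo 1 ((0 : ℤ) : ℝ) = 0
      rw [Int.cast_zero, expo_zero]
    rw [C_apply, embDomain_single, C_apply, h0]
  rw [block, h, mul_comm]

theorem block_one (a : ℝ) : block a 1 = ellPow 0 a := by
  rw [← map_one C, block_C, map_one, one_mul]

/-- The derivation `ℓ d/dℓ` of Laurent series. -/
def laurentEuler (F : LaurentSeries ℝ) : LaurentSeries ℝ where
  coeff n := n * F.coeff n
  isPWO_support' := F.isPWO_support.mono fun _ h => right_ne_zero_of_mul h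

@[simp]
theorem coeff_laurentEuler (F : LaurentSeries ℝ) (n : ℤ) :
    (laurentEuler F).coeff n = n * F.coeff n := rfl

/-- The derivation `x d/dx = ℓ² d/dℓ` of Laurent series in `ℓ`. -/
def laurentD (F : LaurentSeries ℝ) : LaurentSeries ℝ := single 1 1 * laurentEuler F

theorem coeff_laurentD (F : LaurentSeries ℝ) (n : ℤ) :
    (laurentD F).coeff n = (n - 1) * F.coeff (n - 1) := by
  rw [laurentD, coeff_single_mul, one_mul, coeff_laurentEuler]
  push_cast; ring

theorem laurentD_add (F G : LaurentSeries ℝ) : laurentD (F + G) = laurentD F + laurentD G := by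
  ext n
  simp only [coeff_laurentD, coeff_add]; ring

theorem support_laurentEuler_subset (F : LaurentSeries ℝ) : (laurentEuler F).support ⊆ F.support :=
  fun _ h => right_ne_zero_of_mul (mem_support _ _ |>.1 h)

theorem laurentEuler_mul (F G : LaurentSeries ℝ) :
    laurentEuler (F * G) = laurentEuler F * G + F * laurentEuler G := by
  ext n
  rw [coeff_laurentEuler, coeff_add, coeff_mul,
    coeff_mul_left' F.isPWO_support (support_laurentEuler_subset F),
    coeff_mul_right' G.isPWO_support (support_laurentEuler_subset G), ← Finset.sum_add_distrib,
    Finset.mul_sum]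
  refine Finset.sum_congr rfl fun p hp => ?_
  rw [Finset.mem_antidiagonal] at hp
  rw [coeff_laurentEuler, coeff_laurentEuler, ← hp.2.2]
  push_cast; ring

theorem laurentD_mul (F G : LaurentSeries ℝ) :
    laurentD (F * G) = laurentD F * G + F * laurentD G := by
  simp only [laurentD, laurentEuler_mul]; ring

theorem laurentD_C (r : ℝ) : laurentD (C r) = 0 := by
  ext n
  rw [coeff_laurentD, C_apply, coeff_single]
  split_ifs with h
  · have : (n : ℝ) - 1 = ((n - 1 : ℤ) : ℝ) := by push_cast; ring
    rw [this, h]; simp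
  · simp

section RatLaurent

open scoped RatFunc

/-- Laurent expansions at `0` of real rational functions. -/
def ratLaurent : Subfield (LaurentSeries ℝ) :=
  (algebraMap (RatFunc ℝ) (LaurentSeries ℝ)).fieldRange

theorem mem_ratLaurent {F : LaurentSeries ℝ} :
    F ∈ ratLaurent ↔ ∃ R : RatFunc ℝ, (R : LaurentSeries ℝ) = F := RingHom.mem_fieldRange

theorem single_one_mem_ratLaurent : (single 1 1 : LaurentSeries ℝ) ∈ ratLaurent :=
  mem_ratLaurent.2 ⟨RatFunc.X, RatFunc.coe_X⟩

theorem C_mem_ratLaurent (r : ℝ) : (C r : LaurentSeries ℝ) ∈ ratLaurent := by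
  refine mem_ratLaurent.2 ⟨RatFunc.C r, ?_⟩
  have := RatFunc.coe_coe (Polynomial.C r)
  rw [Polynomial.coe_C, PowerSeries.coe_C] at this
  rw [this]
  congr 1

theorem laurentD_single_one : laurentD (single 1 1) = single 1 1 * single 1 1 := by
  ext n
  rw [coeff_laurentD, single_mul_single, coeff_single, coeff_single]
  by_cases h : n = 1 + 1
  · rw [if_pos (by omega), if_pos h, h]; norm_num
  · rw [if_neg (by omega), if_neg h, mul_zero]

/-- The derivation `ℓ² d/dℓ` preserves rationality. -/
theorem laurentD_mem_ratLaurent {F : LaurentSeries ℝ} (hF : F ∈ ratLaurent) :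
    laurentD F ∈ ratLaurent := by
  have hadd : ∀ F G, (F ∈ ratLaurent ∧ laurentD F ∈ ratLaurent) →
      (G ∈ ratLaurent ∧ laurentD G ∈ ratLaurent) →
      (F + G ∈ ratLaurent ∧ laurentD (F + G) ∈ ratLaurent) := fun F G h1 h2 =>
    ⟨add_mem h1.1 h2.1, by rw [laurentD_add]; exact add_mem h1.2 h2.2⟩
  have hmul : ∀ F G, (F ∈ ratLaurent ∧ laurentD F ∈ ratLaurent) →
      (G ∈ ratLaurent ∧ laurentD G ∈ ratLaurent) →
      (F * G ∈ ratLaurent ∧ laurentD (F * G) ∈ ratLaurent) := fun F G h1 h2 =>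
    ⟨mul_mem h1.1 h2.1, by
      rw [laurentD_mul]; exact add_mem (mul_mem h1.2 h2.1) (mul_mem h1.1 h2.2)⟩
  have hinv : ∀ F, (F ∈ ratLaurent ∧ laurentD F ∈ ratLaurent) →
      (F⁻¹ ∈ ratLaurent ∧ laurentD F⁻¹ ∈ ratLaurent) := by
    intro F h
    by_cases h0 : F = 0
    · subst h0; rw [inv_zero]; exact h
    refine ⟨inv_mem h.1, ?_⟩
    have h1 := laurentD_mul F F⁻¹
    rw [mul_inv_cancel₀ h0, ← map_one C, laurentD_C] at h1
    have h2 : laurentD F⁻¹ = -(F⁻¹ * F⁻¹ * laurentD F) := by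
      have h3 : F⁻¹ * F = 1 := inv_mul_cancel₀ h0
      linear_combination (- laurentD F⁻¹) * h3 - F⁻¹ * h1
    rw [h2]
    exact neg_mem (mul_mem (mul_mem (inv_mem h.1) (inv_mem h.1)) h.2)
  have hpoly : ∀ P : Polynomial ℝ, ((algebraMap (Polynomial ℝ) (RatFunc ℝ) P : RatFunc ℝ) :
      LaurentSeries ℝ) ∈ ratLaurent ∧ laurentD ((algebraMap (Polynomial ℝ) (RatFunc ℝ) P :
      RatFunc ℝ) : LaurentSeries ℝ) ∈ ratLaurent := by
    intro P
    induction P using Polynomial.induction_on with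
    | C r =>
      rw [RatFunc.algebraMap_C]
      have := RatFunc.coe_coe (Polynomial.C r)
      rw [Polynomial.coe_C, PowerSeries.coe_C] at this
      have h2 : ((RatFunc.C r : RatFunc ℝ) : LaurentSeries ℝ) = C r := by
        rw [this]; congr 1
      rw [h2, laurentD_C]
      exact ⟨C_mem_ratLaurent r, zero_mem _⟩
    | add P Q hP hQ =>
      rw [map_add, map_add]
      exact hadd _ _ hP hQ
    | monomial n r h =>
      rw [pow_succ, ← mul_assoc, map_mul, map_mul]
      refine hmul _ _ h ?_
      rw [RatFunc.algebraMap_X, RatFunc.coe_X, laurentD_single_one]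
      exact ⟨single_one_mem_ratLaurent,
        mul_mem single_one_mem_ratLaurent single_one_mem_ratLaurent⟩
  obtain ⟨R, rfl⟩ := mem_ratLaurent.1 hF
  induction R using RatFunc.induction_on with
  | f P Q hQ =>
    rw [map_div₀, div_eq_mul_inv]
    exact (hmul _ _ (hpoly P) (hinv _ (hpoly Q))).2

end RatLaurent

theorem ellPow_one_eq_block : ellPow 1 1 = block 0 (single 1 1) := by
  have h : ellExpo 1 = expo 1 1 := by
    change expo 1 ((1 : ℤ) : ℝ) = _
    rw [Int.cast_one]
  rw [block, embDomain_single, ellPow_zero, one_mul, ellPow, h]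

/-- `x d/dx` on a block. -/
theorem eulerD_block (a : ℝ) (F : LaurentSeries ℝ) :
    eulerD (block a F) = block a (C a * F + laurentD F) := by
  have h0 : euler 0 (block a F) = block a (C a * F) := by
    ext γ
    rw [coeff_euler]
    by_cases h : (block a F).coeff γ = 0
    · rw [h, mul_zero]
      symm
      by_contra hne
      obtain ⟨n, rfl, hn⟩ := support_block hne
      rw [coeff_block_xlExpo, if_pos rfl] at h
      rw [C_mul_eq_smul, HahnSeries.coeff_smul, h, smul_zero] at hn
      exact hn rfl
    · obtain ⟨n, rfl, hn⟩ := support_block h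
      rw [coeff_block_xlExpo, coeff_block_xlExpo, if_pos rfl, if_pos rfl, xlExpo_apply_zero,
        C_mul_eq_smul, HahnSeries.coeff_smul, smul_eq_mul]
  have h1 : euler 1 (block a F) = block a (laurentEuler F) := by
    ext γ
    rw [coeff_euler]
    by_cases h : (block a F).coeff γ = 0
    · rw [h, mul_zero]
      symm
      by_contra hne
      obtain ⟨n, rfl, hn⟩ := support_block hne
      rw [coeff_block_xlExpo, if_pos rfl] at h
      rw [coeff_laurentEuler, h, mul_zero] at hn
      exact hn rfl
    · obtain ⟨n, rfl, hn⟩ := support_block h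
      rw [coeff_block_xlExpo, coeff_block_xlExpo, if_pos rfl, if_pos rfl, xlExpo_apply_one,
        coeff_laurentEuler]
  have h2 : euler 2 (block a F) = 0 := by
    ext γ
    rw [coeff_euler, coeff_zero]
    by_cases h : (block a F).coeff γ = 0
    · rw [h, mul_zero]
    · obtain ⟨n, rfl, hn⟩ := support_block h
      rw [xlExpo_apply_of_two_le a n le_rfl, zero_mul]
  rw [eulerD_apply, h0, h1, h2, mul_zero, add_zero, ellPow_one_eq_block, block_mul, zero_add, block_add, laurentD]

/-- The Laurent series `F` of the block `x ^ a * F(ℓ)` of a transseries. -/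
def row (a : ℝ) (g : Transseries) : LaurentSeries ℝ where
  coeff n := g.coeff (xlExpo a n)
  isPWO_support' := by
    rw [Set.isPWO_iff_isWF, Set.isWF_iff_no_descending_seq]
    intro f hf hmem
    have := g.isPWO_support
    rw [Set.isPWO_iff_isWF, Set.isWF_iff_no_descending_seq] at this
    exact this (fun n => xlExpo a (f n)) (fun m n h => (xlExpo_lt_iff a).2 (hf h)) hmem

@[simp]
theorem coeff_row (a : ℝ) (g : Transseries) (n : ℤ) : (row a g).coeff n = g.coeff (xlExpo a n) :=
  rfl

theorem row_add (a : ℝ) (g h : Transseries) : row a (g + h) = row a g + row a h := rfl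

theorem row_zero (a : ℝ) : row a 0 = 0 := rfl

theorem row_neg (a : ℝ) (g : Transseries) : row a (-g) = -row a g := rfl

theorem row_block (a b : ℝ) (F : LaurentSeries ℝ) :
    row b (block a F) = if a = b then F else 0 := by
  ext n
  rw [coeff_row, coeff_block_xlExpo]
  split_ifs <;> rfl

theorem row_ellPow_mul (a b : ℝ) (g : Transseries) :
    row a (ellPow 0 b * g) = row (a - b) g := by
  ext n
  rw [coeff_row, coeff_row, ellPow, coeff_single_mul, one_mul]
  congr 1
  rw [sub_eq_iff_eq_add, xlExpo, xlExpo, add_right_comm, ← expo_add, sub_add_cancel]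

/-! ### The order in `x` -/

/-- All powers of `x` occurring in `g` are at least `c`. -/
def XGe (c : ℝ) (g : Transseries) : Prop := ∀ γ ∈ g.support, c ≤ ofLex γ 0

theorem XGe.mono {c d : ℝ} {g : Transseries} (h : XGe c g) (hd : d ≤ c) : XGe d g :=
  fun γ hγ => hd.trans (h γ hγ)

theorem XGe.coeff_eq_zero {c : ℝ} {g : Transseries} (h : XGe c g) {γ : Expo} (hγ : ofLex γ 0 < c) :
    g.coeff γ = 0 := by
  by_contra hne
  exact absurd (h γ hne) (not_le.2 hγ)

theorem XGe.add {c : ℝ} {g h : Transseries} (hg : XGe c g) (hh : XGe c h) : XGe c (g + h) := by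
  intro γ hγ
  rcases support_add_subset _ _ hγ with h1 | h1
  · exact hg γ h1
  · exact hh γ h1

theorem XGe.neg {c : ℝ} {g : Transseries} (hg : XGe c g) : XGe c (-g) := by
  intro γ hγ
  rw [support_neg] at hγ
  exact hg γ hγ

theorem XGe.sub {c : ℝ} {g h : Transseries} (hg : XGe c g) (hh : XGe c h) : XGe c (g - h) := by
  rw [sub_eq_add_neg]; exact hg.add hh.neg

theorem XGe.mul {c d : ℝ} {g h : Transseries} (hg : XGe c g) (hh : XGe d h) :
    XGe (c + d) (g * h) := by
  intro γ hγ
  obtain ⟨a, ha, b, hb, rfl⟩ := support_mul_subset hγ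
  exact add_le_add (hg a ha) (hh b hb)

theorem xGe_block (a : ℝ) (F : LaurentSeries ℝ) : XGe a (block a F) := by
  intro γ hγ
  obtain ⟨n, rfl, -⟩ := support_block hγ
  rw [xlExpo_apply_zero]

theorem xGe_ellPow (a : ℝ) : XGe a (ellPow 0 a) := by
  rw [← block_one]; exact xGe_block a 1

theorem xGe_C (r : ℝ) : XGe 0 (C r) := by
  have := xGe_block 0 (C r)
  rwa [block_C, ellPow_zero, mul_one] at this

theorem XGe.pow {c : ℝ} {g : Transseries} (hg : XGe c g) (n : ℕ) : XGe (n * c) (g ^ n) := by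
  induction n with
  | zero => rw [pow_zero, ← map_one C, Nat.cast_zero, zero_mul]; exact xGe_C 1
  | succ n ih =>
    rw [pow_succ]
    have := ih.mul hg
    convert this using 1
    push_cast; ring

theorem eulerExpo_first {γ : Expo} (h : γ ∈ eulerExpo) : ofLex γ 0 = 0 := by
  induction h using AddSubmonoid.closure_induction with
  | mem z hz =>
    rcases hz with rfl | rfl
    · rw [expo_apply, if_neg one_ne_zero]
    · rw [ofLex_add_apply, expo_apply, expo_apply, if_neg one_ne_zero, if_neg two_ne_zero, add_zero]
  | zero => rfl
  | add a b _ _ ha hb => rw [ofLex_add_apply, ha, hb, add_zero]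

theorem XGe.eulerD {c : ℝ} {g : Transseries} (hg : XGe c g) : XGe c (eulerD g) := by
  intro γ hγ
  obtain ⟨a, ha, b, hb, rfl⟩ := support_eulerD_subset g hγ
  change c ≤ ofLex a 0 + ofLex b 0
  rw [eulerExpo_first hb, add_zero]
  exact hg a ha

theorem closure_first_nonneg {τ : Transseries} (hτ : 0 < τ.orderTop) {γ : Expo}
    (h : γ ∈ AddSubmonoid.closure τ.support) : 0 ≤ ofLex γ 0 := by
  have : (0 : Expo) ≤ γ := by
    induction h using AddSubmonoid.closure_induction with
    | mem z hz => exact support_nonneg_of_orderTop_pos hτ z hz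
    | zero => exact le_rfl
    | add a b _ _ ha hb => exact add_nonneg ha hb
  exact first_le_of_le this

theorem XGe.taylorOp {d : ℝ} {g : Transseries} (hg : XGe d g) (c : ℕ → ℝ) {τ : Transseries}
    (hτ : 0 < τ.orderTop) : XGe d (taylorOp c τ g) := by
  intro γ hγ
  obtain ⟨a, ha, b, ⟨b1, hb1, b2, hb2, rfl⟩, rfl⟩ := support_taylorOp_subset c hτ g hγ
  change d ≤ ofLex a 0 + (ofLex b1 0 + ofLex b2 0)
  rw [eulerExpo_first hb2, add_zero]
  exact (hg a ha).trans (le_add_of_nonneg_right (closure_first_nonneg hτ hb1))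

theorem xGe_heval {x : Transseries} (hx : 0 < x.orderTop) (p : PowerSeries ℝ) :
    XGe 0 (PowerSeries.heval x p) := fun _ hγ =>
  closure_first_nonneg hx (support_heval_subset x p hγ)

theorem row_eq_zero_of_xGe {a c : ℝ} {g : Transseries} (h : XGe c g) (ha : a < c) :
    row a g = 0 := by
  ext n
  rw [coeff_row, coeff_zero]
  exact h.coeff_eq_zero (by rwa [xlExpo_apply_zero])

theorem eq_zero_of_forall_xGe {g : Transseries} (h : ∀ c, XGe c g) : g = 0 := by
  ext γ
  exact (h (ofLex γ 0 + 1)).coeff_eq_zero (by linarith)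

/-- If `s n` has `x`-order at least `n * μ`, with `μ > 0`, the family `s` is summable. -/
def xSummable (s : ℕ → Transseries) {μ : ℝ} (hμ : 0 < μ) (hs : ∀ n : ℕ, XGe (n * μ) (s n)) :
    SummableFamily Expo ℝ ℕ where
  toFun := s
  isPWO_iUnion_support' := by
    rw [Set.isPWO_iff_isWF, Set.isWF_iff_no_descending_seq]
    intro f hf hmem
    obtain ⟨N, hN⟩ := exists_nat_gt (ofLex (f 0) 0 / μ)
    rw [div_lt_iff₀ hμ] at hN
    have hfin : (⋃ n ∈ Finset.range N, (s n).support).IsPWO := by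
      exact (Finset.isPWO_bUnion (Finset.range N)).2 fun n _ => (s n).isPWO_support
    rw [Set.isPWO_iff_isWF, Set.isWF_iff_no_descending_seq] at hfin
    refine hfin f hf fun n => ?_
    obtain ⟨k, hk⟩ := Set.mem_iUnion.1 (hmem n)
    refine Set.mem_biUnion (x := k) ?_ hk
    rw [Finset.mem_coe, Finset.mem_range]
    have h1 := (hs k _ hk).trans (first_le_of_le (hf.antitone (Nat.zero_le n)))
    have h2 := h1.trans_lt hN
    exact_mod_cast lt_of_mul_lt_mul_right h2 hμ.le
  finite_co_support' γ := by
    obtain ⟨N, hN⟩ := exists_nat_gt (ofLex γ 0 / μ)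
    rw [div_lt_iff₀ hμ] at hN
    refine (Finset.range N).finite_toSet.subset fun k hk => ?_
    rw [Finset.mem_coe, Finset.mem_range]
    have h2 := (hs k γ hk).trans_lt hN
    exact_mod_cast lt_of_mul_lt_mul_right h2 hμ.le

theorem xGe_hsum_sub_sum (s : ℕ → Transseries) {μ : ℝ} (hμ : 0 < μ)
    (hs : ∀ n : ℕ, XGe (n * μ) (s n)) (N : ℕ) :
    XGe (N * μ) ((xSummable s hμ hs).hsum - ∑ n ∈ Finset.range N, s n) := by
  intro γ hγ
  by_contra hcon
  rw [not_le] at hcon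
  apply hγ
  rw [coeff_sub, HahnSeries.coeff_sum,
    SummableFamily.coeff_hsum_eq_sum_of_subset (t := Finset.range N), sub_eq_zero]
  · rfl
  · intro k hk
    rw [Finset.mem_coe, Finset.mem_range]
    have h2 := (hs k γ hk).trans_lt hcon
    exact_mod_cast lt_of_mul_lt_mul_right h2 hμ.le

/-! ### Transseries with rational blocks -/

/-- A submonoid of `[0, ∞)` with finitely many elements below every bound. -/
structure IsDiscrete (M : AddSubmonoid ℝ) : Prop where
  nonneg : ∀ a ∈ M, 0 ≤ a
  finite : ∀ c : ℝ, {a | a ∈ M ∧ a ≤ c}.Finite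

/-- The transseries `∑ x ^ a * F_a(ℓ)` with exponents `a ∈ M` and all `F_a` rational. -/
structure RatIn (M : AddSubmonoid ℝ) (g : Transseries) : Prop where
  support : ∀ γ ∈ g.support, ∃ a ∈ M, ∃ n : ℤ, γ = xlExpo a n
  row_mem : ∀ a, row a g ∈ ratLaurent

section RatIn

variable {M : AddSubmonoid ℝ}

theorem RatIn.mono {M' : AddSubmonoid ℝ} (hMM : M ≤ M') {g : Transseries} (h : RatIn M g) :
    RatIn M' g :=
  ⟨fun γ hγ => by
    obtain ⟨a, ha, n, rfl⟩ := h.support γ hγ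
    exact ⟨a, hMM ha, n, rfl⟩, h.row_mem⟩

theorem RatIn.add {g h : Transseries} (hg : RatIn M g) (hh : RatIn M h) : RatIn M (g + h) := by
  refine ⟨fun γ hγ => ?_, fun a => by rw [row_add]; exact add_mem (hg.row_mem a) (hh.row_mem a)⟩
  rcases support_add_subset _ _ hγ with h1 | h1
  · exact hg.support γ h1
  · exact hh.support γ h1

theorem RatIn.neg {g : Transseries} (hg : RatIn M g) : RatIn M (-g) := by
  refine ⟨fun γ hγ => ?_, fun a => by rw [row_neg]; exact neg_mem (hg.row_mem a)⟩
  rw [support_neg] at hγ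
  exact hg.support γ hγ

theorem RatIn.sub {g h : Transseries} (hg : RatIn M g) (hh : RatIn M h) : RatIn M (g - h) := by
  rw [sub_eq_add_neg]; exact hg.add hh.neg

theorem ratIn_block {a : ℝ} (ha : a ∈ M) {F : LaurentSeries ℝ} (hF : F ∈ ratLaurent) :
    RatIn M (block a F) := by
  refine ⟨fun γ hγ => ?_, fun b => ?_⟩
  · obtain ⟨n, rfl, -⟩ := support_block hγ
    exact ⟨a, ha, n, rfl⟩
  · rw [row_block]
    split_ifs
    · exact hF
    · exact zero_mem _

theorem ratIn_C (r : ℝ) : RatIn M (C r) := by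
  have := ratIn_block (zero_mem M) (C_mem_ratLaurent r)
  rwa [block_C, ellPow_zero, mul_one] at this

theorem ratIn_zero : RatIn M 0 := by
  have := ratIn_C (M := M) 0
  rwa [map_zero] at this

theorem ratIn_one : RatIn M 1 := by
  have := ratIn_C (M := M) 1
  rwa [map_one] at this

theorem RatIn.sum {ι : Type*} {s : Finset ι} {f : ι → Transseries} (h : ∀ i ∈ s, RatIn M (f i)) :
    RatIn M (∑ i ∈ s, f i) :=
  Finset.sum_induction f (RatIn M) (fun _ _ => RatIn.add) ratIn_zero h

theorem RatIn.xGe_zero (hM : IsDiscrete M) {g : Transseries} (hg : RatIn M g) : XGe 0 g := by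
  intro γ hγ
  obtain ⟨a, ha, n, rfl⟩ := hg.support γ hγ
  rw [xlExpo_apply_zero]
  exact hM.nonneg a ha

/-- The class of transseries with rational blocks is closed for the topology of the `x`-order. -/
theorem RatIn.of_approx {g : Transseries} (h : ∀ c, ∃ y, RatIn M y ∧ XGe c (g - y)) :
    RatIn M g := by
  refine ⟨fun γ hγ => ?_, fun a => ?_⟩
  · obtain ⟨y, hy, hgy⟩ := h (ofLex γ 0 + 1)
    have h1 := hgy.coeff_eq_zero (γ := γ) (by linarith)
    rw [coeff_sub, sub_eq_zero] at h1
    exact hy.support γ (by rw [mem_support, ← h1]; exact hγ)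
  · obtain ⟨y, hy, hgy⟩ := h (a + 1)
    have h1 := row_eq_zero_of_xGe hgy (by linarith : a < a + 1)
    have h2 : row a g = row a y := by
      rw [← sub_add_cancel g y, row_add, h1, zero_add]
    rw [h2]
    exact hy.row_mem a

/-- Truncation: up to terms of large `x`-order, `g` is a finite sum of rational blocks. -/
theorem RatIn.exists_sum_block (hM : IsDiscrete M) {g : Transseries} (hg : RatIn M g) (c : ℝ) :
    ∃ s : Finset ℝ, (∀ a ∈ s, a ∈ M) ∧ XGe c (g - ∑ a ∈ s, block a (row a g)) := by
  refine ⟨(hM.finite c).toFinset, fun a ha => ((hM.finite c).mem_toFinset.1 ha).1, fun γ hγ => ?_⟩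
  by_contra hcon
  rw [not_le] at hcon
  apply hγ
  rw [coeff_sub, HahnSeries.coeff_sum, sub_eq_zero]
  by_cases h0 : g.coeff γ = 0
  · rw [h0]
    symm
    refine Finset.sum_eq_zero fun a _ => ?_
    by_contra hne
    obtain ⟨n, rfl, hn⟩ := support_block hne
    exact hn h0
  · obtain ⟨a, ha, n, rfl⟩ := hg.support γ h0
    rw [xlExpo_apply_zero] at hcon
    rw [Finset.sum_eq_single a]
    · rw [coeff_block_xlExpo, if_pos rfl, coeff_row]
    · intro b _ hb
      rw [coeff_block_xlExpo, if_neg hb]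
    · intro hn
      exact absurd ((hM.finite c).mem_toFinset.2 ⟨ha, hcon.le⟩) hn

theorem RatIn.mul (hM : IsDiscrete M) {g h : Transseries} (hg : RatIn M g) (hh : RatIn M h) :
    RatIn M (g * h) := by
  refine RatIn.of_approx fun c => ?_
  obtain ⟨s, hs, hgs⟩ := hg.exists_sum_block hM c
  obtain ⟨t, ht, hht⟩ := hh.exists_sum_block hM c
  refine ⟨(∑ a ∈ s, block a (row a g)) * ∑ b ∈ t, block b (row b h), ?_, ?_⟩
  · rw [Finset.sum_mul_sum]
    refine RatIn.sum fun a ha => RatIn.sum fun b hb => ?_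
    rw [block_mul]
    exact ratIn_block (add_mem (hs a ha) (ht b hb)) (mul_mem (hg.row_mem a) (hh.row_mem b))
  · set g' := ∑ a ∈ s, block a (row a g) with hg'
    have hg'0 : XGe 0 g' :=
      (RatIn.sum fun a ha => ratIn_block (hs a ha) (hg.row_mem a) : RatIn M g').xGe_zero hM
    set h' := ∑ b ∈ t, block b (row b h)
    have h1 := hgs.mul (hh.xGe_zero hM)
    have h2 := hg'0.mul hht
    rw [add_zero] at h1
    rw [zero_add] at h2
    convert h1.add h2 using 1
    ring

theorem RatIn.pow (hM : IsDiscrete M) {g : Transseries} (hg : RatIn M g) (n : ℕ) :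
    RatIn M (g ^ n) := by
  induction n with
  | zero => rw [pow_zero]; exact ratIn_one
  | succ n ih => rw [pow_succ]; exact ih.mul hM hg

theorem RatIn.eulerD (hM : IsDiscrete M) {g : Transseries} (hg : RatIn M g) :
    RatIn M (eulerD g) := by
  refine RatIn.of_approx fun c => ?_
  obtain ⟨s, hs, hgs⟩ := hg.exists_sum_block hM c
  refine ⟨Dulac.eulerD (∑ a ∈ s, block a (row a g)), ?_, ?_⟩
  · rw [map_sum]
    refine RatIn.sum fun a ha => ?_
    rw [eulerD_block]
    exact ratIn_block (hs a ha) (add_mem (mul_mem (C_mem_ratLaurent a) (hg.row_mem a))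
      (laurentD_mem_ratLaurent (hg.row_mem a)))
  · rw [← map_sub]
    exact hgs.eulerD

theorem RatIn.heval (hM : IsDiscrete M) {x : Transseries} (hx : RatIn M x) {μ : ℝ} (hμ : 0 < μ)
    (hxμ : XGe μ x) (hx0 : 0 < x.orderTop) (p : PowerSeries ℝ) :
    RatIn M (PowerSeries.heval x p) := by
  have key : ∀ K : ℕ, ∃ y, RatIn M y ∧ ∃ q : PowerSeries ℝ,
      PowerSeries.heval x p = y + x ^ K * PowerSeries.heval x q := by
    intro K
    induction K with
    | zero => exact ⟨0, ratIn_zero, p, by simp⟩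
    | succ K ih =>
      obtain ⟨y, hy, q, hq⟩ := ih
      obtain ⟨r, hr⟩ := heval_eq_C_add x hx0 q
      refine ⟨y + x ^ K * C (PowerSeries.constantCoeff q),
        hy.add ((hx.pow hM K).mul hM (ratIn_C _)), r, ?_⟩
      rw [hq, hr, pow_succ]
      ring
  refine RatIn.of_approx fun c => ?_
  obtain ⟨K, hK⟩ := exists_nat_gt (c / μ)
  rw [div_lt_iff₀ hμ] at hK
  obtain ⟨y, hy, q, hq⟩ := key K
  refine ⟨y, hy, ?_⟩
  rw [hq, add_sub_cancel_left]
  have := (hxμ.pow K).mul (xGe_heval hx0 q)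
  rw [add_zero] at this
  exact this.mono hK.le

theorem ellPow_mul_eulerD (δ : ℝ) (y : Transseries) :
    ellPow 0 δ * Dulac.eulerD (ellPow 0 (-δ) * y) = Dulac.eulerD y - C δ * y := by
  have h : ellPow 0 δ * ellPow 0 (-δ) = 1 := by rw [← ellPow_add, add_neg_cancel, ellPow_zero]
  rw [eulerD_mul, eulerD_ellPow_zero, map_neg]
  linear_combination (Dulac.eulerD y - C δ * y) * h

/-- Operators of infinite order, conjugated by a power of `x`, preserve rationality of blocks. -/
theorem RatIn.taylorOp (hM : IsDiscrete M) {τ : Transseries} (hτ : RatIn M τ) {μ : ℝ} (hμ : 0 < μ)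
    (hτμ : XGe μ τ) (hτ0 : 0 < τ.orderTop) (c : ℕ → ℝ) (δ : ℝ) {y : Transseries} (hy : RatIn M y) :
    RatIn M (ellPow 0 δ * taylorOp c τ (ellPow 0 (-δ) * y)) := by
  have hδ : ellPow 0 δ * ellPow 0 (-δ) = 1 := by rw [← ellPow_add, add_neg_cancel, ellPow_zero]
  have key : ∀ K : ℕ, ∃ z, RatIn M z ∧ ∃ (c' : ℕ → ℝ) (w : Transseries), RatIn M w ∧
      ellPow 0 δ * Dulac.taylorOp c τ (ellPow 0 (-δ) * y) =
        z + τ ^ K * (ellPow 0 δ * Dulac.taylorOp c' τ (ellPow 0 (-δ) * w)) := by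
    intro K
    induction K with
    | zero => exact ⟨0, ratIn_zero, c, y, hy, by simp⟩
    | succ K ih =>
      obtain ⟨z, hz, c', w, hw, hq⟩ := ih
      refine ⟨z + τ ^ K * (C (c' 0) * w), hz.add ((hτ.pow hM K).mul hM ((ratIn_C _).mul hM hw)),
        fun k => c' (k + 1), Dulac.eulerD w - C δ * w,
        (hw.eulerD hM).sub ((ratIn_C δ).mul hM hw), ?_⟩
      have h1 : ellPow 0 (-δ) * (Dulac.eulerD w - C δ * w) =
          Dulac.eulerD (ellPow 0 (-δ) * w) := by
        rw [← ellPow_mul_eulerD]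
        linear_combination (Dulac.eulerD (ellPow 0 (-δ) * w)) * hδ
      rw [hq, taylorOp_shift c' hτ0, h1, pow_succ]
      linear_combination (τ ^ K * C (c' 0) * w) * hδ
  refine RatIn.of_approx fun d => ?_
  obtain ⟨K, hK⟩ := exists_nat_gt (d / μ)
  rw [div_lt_iff₀ hμ] at hK
  obtain ⟨z, hz, c', w, hw, hq⟩ := key K
  refine ⟨z, hz, ?_⟩
  rw [hq, add_sub_cancel_left]
  have h1 := (((xGe_ellPow (-δ)).mul (hw.xGe_zero hM)).taylorOp c' hτ0)
  have := (hτμ.pow K).mul ((xGe_ellPow δ).mul h1)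
  refine this.mono ?_
  linarith

theorem RatIn.xGe_sub_block_zero {μ : ℝ} (hμM : ∀ a ∈ M, a ≠ 0 → μ ≤ a)
    {g : Transseries} (hg : RatIn M g) : XGe μ (g - block 0 (row 0 g)) := by
  intro γ hγ
  obtain ⟨a, ha, n, rfl⟩ := (hg.sub (ratIn_block (zero_mem M) (hg.row_mem 0))).support γ hγ
  rw [xlExpo_apply_zero]
  refine hμM a ha ?_
  rintro rfl
  apply hγ
  rw [coeff_sub, coeff_block_xlExpo, if_pos rfl, coeff_row, sub_self]

end RatIn

/-! ### The derivative of the Fatou coordinate -/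

/-- The Abel equation `∑ τ ^ (k + 1) / (k + 1)! * (x d/dx) ^ k G = 1` for the derivative
`G = x d/dx Ψ` has a solution with rational blocks. -/
theorem exists_derivative_solution {M : AddSubmonoid ℝ} (hM : IsDiscrete M) {τ : Transseries}
    (hτ0 : 0 < τ.orderTop) {δ μ : ℝ} (hμ : 0 < μ)
    (hμM : ∀ a ∈ M, a ≠ 0 → μ ≤ a) (hτ : RatIn M τ) (hτμ : XGe μ τ)
    (hτδ : RatIn M (ellPow 0 (-δ) * τ)) (hq : row δ τ ≠ 0) :
    ∃ G, τ * taylorOp (fun k => expCoeff (k + 1)) τ G = 1 ∧ RatIn M (ellPow 0 δ * G) ∧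
      row (-δ) G ≠ 0 := by
  set c1 : ℕ → ℝ := fun k => expCoeff (k + 1) with hc1
  have hδ : ellPow 0 δ * ellPow 0 (-δ) = 1 := by rw [← ellPow_add, add_neg_cancel, ellPow_zero]
  set τ₁ := ellPow 0 (-δ) * τ with hτ₁
  set q := row δ τ with hqdef
  have hqrow : row 0 τ₁ = q := by rw [hτ₁, row_ellPow_mul, zero_sub, neg_neg]
  have hqrat : q ∈ ratLaurent := hτ.row_mem δ
  set Q := block 0 q⁻¹ with hQ
  have hQrat : RatIn M Q := ratIn_block (zero_mem M) (inv_mem hqrat)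
  -- the left side of the equation is nearly multiplication by the first block `x ^ δ * q` of `τ`;
  -- `Λ` is the error made by inverting that block only, and it raises the order in `x` by `μ`
  let Λ : Transseries →ₗ[ℝ] Transseries :=
    LinearMap.id - mulOp τ ∘ₗ taylorOp c1 τ ∘ₗ mulOp (ellPow 0 (-δ) * Q)
  have hΛ : ∀ d, Λ d = d - τ * taylorOp c1 τ (ellPow 0 (-δ) * (Q * d)) := by
    intro d
    rw [← mul_assoc (ellPow 0 (-δ))]; rfl
  have hΛrat : ∀ d, RatIn M d → RatIn M (Λ d) := by
    intro d hd
    have h1 := RatIn.taylorOp hM hτ hμ hτμ hτ0 c1 δ (hQrat.mul hM hd)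
    have h2 : τ * taylorOp c1 τ (ellPow 0 (-δ) * (Q * d)) =
        τ₁ * (ellPow 0 δ * taylorOp c1 τ (ellPow 0 (-δ) * (Q * d))) := by
      rw [hτ₁]
      linear_combination (- τ * taylorOp c1 τ (ellPow 0 (-δ) * (Q * d))) * hδ
    rw [hΛ, h2]
    exact hd.sub (hτδ.mul hM h1)
  have hη : XGe μ (1 - τ₁ * Q) := by
    have h1 := hτδ.xGe_sub_block_zero hμM
    rw [hqrow] at h1
    have h2 : block 0 q * Q = 1 := by
      rw [hQ, block_mul, mul_inv_cancel₀ hq, add_zero, block_one, ellPow_zero]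
    have h3 := (h1.mul (xGe_block 0 q⁻¹)).neg
    rw [add_zero] at h3
    convert h3 using 1
    linear_combination -h2
  have hΛX : ∀ c d, XGe c d → XGe (c + μ) (Λ d) := by
    intro c d hd
    have h1 : Λ d = (1 - τ₁ * Q) * d -
        τ₁ * (ellPow 0 δ * (τ * taylorOp (fun k => c1 (k + 1)) τ
          (eulerD (ellPow 0 (-δ) * (Q * d))))) := by
      rw [hΛ, taylorOp_shift c1 hτ0]
      have h2 : c1 0 = 1 := by simp [hc1, expCoeff]
      rw [h2, map_one, hτ₁]
      linear_combination (τ * (τ * taylorOp (fun k => c1 (k + 1)) τ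
          (eulerD (ellPow 0 (-δ) * (Q * d))))) * hδ
    have h2 : XGe (-δ + (0 + c)) (ellPow 0 (-δ) * (Q * d)) :=
      (xGe_ellPow (-δ)).mul ((xGe_block 0 q⁻¹).mul hd)
    have h3 := (hτδ.xGe_zero hM).mul ((xGe_ellPow δ).mul
      (hτμ.mul (h2.eulerD.taylorOp (fun k => c1 (k + 1)) hτ0)))
    rw [h1]
    refine XGe.sub ?_ ?_
    · rw [add_comm]; exact hη.mul hd
    · refine h3.mono ?_
      linarith
  have hpow : ∀ n : ℕ, RatIn M (Λ^[n] 1) ∧ XGe (n * μ) (Λ^[n] 1) := by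
    intro n
    induction n with
    | zero =>
      refine ⟨ratIn_one, ?_⟩
      rw [Nat.cast_zero, zero_mul]
      exact ratIn_one.xGe_zero hM
    | succ n ih =>
      rw [Function.iterate_succ', Function.comp_apply]
      refine ⟨hΛrat _ ih.1, ?_⟩
      have := hΛX _ _ ih.2
      convert this using 1
      push_cast; ring
  -- the Neumann series for `(1 - Λ) G₁ = 1`
  set G₁ := (xSummable (fun n => Λ^[n] 1) hμ fun n => (hpow n).2).hsum with hG₁
  have happ : ∀ N : ℕ, XGe (N * μ) (G₁ - ∑ n ∈ Finset.range N, Λ^[n] 1) :=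
    xGe_hsum_sub_sum _ hμ fun n => (hpow n).2
  have harch : ∀ c : ℝ, ∃ N : ℕ, c ≤ N * μ := by
    intro c
    obtain ⟨N, hN⟩ := exists_nat_gt (c / μ)
    rw [div_lt_iff₀ hμ] at hN
    exact ⟨N, hN.le⟩
  have hG₁rat : RatIn M G₁ := by
    refine RatIn.of_approx fun c => ?_
    obtain ⟨N, hN⟩ := harch c
    exact ⟨_, RatIn.sum fun n _ => (hpow n).1, (happ N).mono hN⟩
  have hfix : G₁ - 1 - Λ G₁ = 0 := by
    refine eq_zero_of_forall_xGe fun c => ?_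
    obtain ⟨N, hN⟩ := harch c
    have h1 := happ N
    have h2 := (hΛX _ _ h1).mono (by linarith : (N : ℝ) * μ ≤ N * μ + μ)
    rw [map_sub, map_sum] at h2
    have h3 : ∑ n ∈ Finset.range N, Λ (Λ^[n] 1) + 1 =
        ∑ n ∈ Finset.range N, Λ^[n] 1 + Λ^[N] 1 := by
      rw [← Finset.sum_range_succ, Finset.sum_range_succ']
      simp only [Function.iterate_succ', Function.comp_apply, Function.iterate_zero, id_eq]
    have h4 := ((h1.sub h2).sub (hpow N).2).mono hN
    convert h4 using 1
    linear_combination -h3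
  refine ⟨ellPow 0 (-δ) * (Q * G₁), ?_, ?_, ?_⟩
  · rw [hΛ] at hfix
    linear_combination hfix
  · have h1 : ellPow 0 δ * (ellPow 0 (-δ) * (Q * G₁)) = Q * G₁ := by
      linear_combination (Q * G₁) * hδ
    rw [h1]
    exact hQrat.mul hM hG₁rat
  · have h1 : Q * G₁ = Q + Q * Λ G₁ := by linear_combination Q * hfix
    have h2 : XGe μ (Q * Λ G₁) := by
      have := (xGe_block 0 q⁻¹).mul (hΛX 0 _ (hG₁rat.xGe_zero hM))
      rwa [zero_add, zero_add] at this
    rw [row_ellPow_mul, sub_self, h1, row_add, row_eq_zero_of_xGe h2 hμ, add_zero, hQ, row_block,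
      if_pos rfl]
    exact inv_ne_zero hq

/-! ### Formal integration -/

/-- Integration of `x ^ (a - 1) * R(ℓ)` for `a ≠ 0`: the equation `a F + ℓ² F' = R` is solved
recursively, starting from the lowest power of `ℓ` in `R`. -/
theorem exists_antideriv_of_ne_zero {a : ℝ} (ha : a ≠ 0) (R : LaurentSeries ℝ) :
    ∃ F : LaurentSeries ℝ, C a * F + laurentD F = R ∧
      ∀ n, F.coeff n ≠ 0 → ∃ n', R.coeff n' ≠ 0 ∧ n' ≤ n := by
  by_cases hR : R = 0
  · refine ⟨0, ?_, fun n hn => absurd rfl hn⟩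
    rw [hR, mul_zero, zero_add]
    ext n
    simp [coeff_laurentD]
  set m := R.order with hm
  let c : ℕ → ℝ := fun k => Nat.rec (R.coeff m / a)
    (fun k y => (R.coeff (m + k + 1) - (m + k) * y) / a) k
  have hc0 : c 0 = R.coeff m / a := rfl
  have hcs : ∀ k : ℕ, c (k + 1) = (R.coeff (m + k + 1) - (m + k) * c k) / a := fun k => rfl
  let F : LaurentSeries ℝ := single m 1 * ofPowerSeries ℤ ℝ (PowerSeries.mk c)
  have hFlt : ∀ n < m, F.coeff n = 0 := by
    intro n hn
    change (single m 1 * ofPowerSeries ℤ ℝ (PowerSeries.mk c)).coeff n = 0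
    rw [coeff_single_mul, PowerSeries.coeff_coe, if_pos (by omega), mul_zero]
  have hF : ∀ k : ℕ, F.coeff (m + k) = c k := by
    intro k
    change (single m 1 * ofPowerSeries ℤ ℝ (PowerSeries.mk c)).coeff (m + k) = c k
    rw [coeff_single_mul, PowerSeries.coeff_coe, if_neg (by omega), one_mul, PowerSeries.coeff_mk]
    congr 1
    omega
  refine ⟨F, ?_, fun n hn => ⟨m, fun h0 => hR (HahnSeries.coeff_order_eq_zero.1 h0), ?_⟩⟩
  · ext n
    rw [coeff_add, C_mul_eq_smul, HahnSeries.coeff_smul, smul_eq_mul, coeff_laurentD]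
    rcases lt_or_ge n m with hn | hn
    · rw [hFlt n hn, hFlt (n - 1) (by omega), mul_zero, mul_zero, add_zero]
      exact (coeff_eq_zero_of_lt_order hn).symm
    · obtain ⟨k, rfl⟩ := Int.le.dest hn
      rw [hF]
      cases k with
      | zero =>
        rw [hFlt _ (by simp), mul_zero, add_zero, hc0]
        field_simp
        simp
      | succ k =>
        have h1 : m + ((k + 1 : ℕ) : ℤ) - 1 = m + k := by push_cast; ring
        rw [h1, hF, hcs, mul_div_cancel₀ _ ha]
        push_cast
        rw [← add_assoc m]
        ring
  · by_contra hcon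
    exact hn (hFlt n (not_le.1 hcon))

/-- Integration of `x⁻¹ * R(ℓ)`: only the residue, the coefficient of `x⁻¹ * ℓ`, has no
antiderivative of the form `F(ℓ)`. -/
theorem exists_antideriv_zero (R : LaurentSeries ℝ) :
    ∃ F : LaurentSeries ℝ, laurentD F = R - C (R.coeff 1) * single 1 1 ∧
      ∀ n, F.coeff n ≠ 0 → ∃ n', R.coeff n' ≠ 0 ∧ n' - 1 ≤ n := by
  let S : LaurentSeries ℝ := single (-1) 1 * R
  have hS : ∀ n, S.coeff n = R.coeff (n + 1) := by
    intro n
    change (single (-1) 1 * R).coeff n = _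
    rw [coeff_single_mul, one_mul, sub_neg_eq_add]
  -- at `n = 0` the quotient is `0`, the chosen constant of integration
  let F : LaurentSeries ℝ :=
    { coeff := fun n => S.coeff n / n
      isPWO_support' := S.isPWO_support.mono fun n hn => by
        rw [mem_support]
        rintro h0
        exact hn (by simp [h0]) }
  have hF : ∀ n, F.coeff n = R.coeff (n + 1) / n := fun n => by rw [← hS]
  refine ⟨F, ?_, fun n hn => ⟨n + 1, fun h0 => hn (by rw [hF, h0, zero_div]), by omega⟩⟩
  ext n
  rw [coeff_laurentD, hF, coeff_sub, C_mul_eq_smul, HahnSeries.coeff_smul, sub_add_cancel,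
    coeff_single, smul_eq_mul]
  split_ifs with h
  · rw [h]; norm_num
  · have : (n : ℝ) - 1 ≠ 0 := by
      rw [sub_ne_zero]; exact_mod_cast h
    push_cast
    field_simp
    ring

/-- The support of `g` consists of exponents of `x ^ a * ℓ ^ n` with `a ∈ A` and `n` an integer. -/
def XLSupport (A : Set ℝ) (g : Transseries) : Prop :=
  ∀ γ ∈ g.support, ∃ a ∈ A, ∃ n : ℤ, γ = xlExpo a n

theorem XLSupport.add {A : Set ℝ} {g h : Transseries} (hg : XLSupport A g) (hh : XLSupport A h) :
    XLSupport A (g + h) := by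
  intro γ hγ
  rcases support_add_subset _ _ hγ with h1 | h1
  · exact hg γ h1
  · exact hh γ h1

theorem xlSupport_block {A : Set ℝ} {a : ℝ} (ha : a ∈ A) (F : LaurentSeries ℝ) :
    XLSupport A (block a F) := by
  intro γ hγ
  obtain ⟨n, rfl, -⟩ := support_block hγ
  exact ⟨a, ha, n, rfl⟩

theorem xlSupport_C {A : Set ℝ} (h0 : (0 : ℝ) ∈ A) (r : ℝ) : XLSupport A (C r) := by
  have := xlSupport_block h0 (C r)
  rwa [block_C, ellPow_zero, mul_one] at this

theorem row_C_mul_ellPow_one (a r : ℝ) :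
    row a (C r * ellPow 1 1) = if 0 = a then C r * single 1 1 else 0 := by
  have h := block_mul 0 0 (C r) (single 1 1)
  rw [block_C, ellPow_zero, mul_one, add_zero, ← ellPow_one_eq_block] at h
  rw [h, row_block]

theorem XLSupport.euler_two {A : Set ℝ} {h : Transseries} (hh : XLSupport A h) : euler 2 h = 0 := by
  ext γ
  rw [coeff_euler, coeff_zero]
  by_cases h1 : h.coeff γ = 0
  · rw [h1, mul_zero]
  · obtain ⟨a, -, n, rfl⟩ := hh γ h1
    rw [xlExpo_apply_of_two_le a n le_rfl, zero_mul]

theorem XLSupport.row_eulerD {A : Set ℝ} {h : Transseries} (hh : XLSupport A h) (a : ℝ) :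
    row a (eulerD h) = C a * row a h + laurentD (row a h) := by
  have h2 := hh.euler_two
  ext n
  rw [coeff_row, eulerD_apply, h2, mul_zero, add_zero, coeff_add, coeff_euler, xlExpo_apply_zero,
    ellPow, coeff_single_mul, one_mul, coeff_euler, coeff_add, C_mul_eq_smul, HahnSeries.coeff_smul,
    smul_eq_mul, coeff_row, coeff_laurentD, coeff_row]
  have h3 : xlExpo a n - expo 1 1 = xlExpo a (n - 1) := by
    rw [sub_eq_iff_eq_add, xlExpo, xlExpo, add_assoc, ← expo_add]
    push_cast
    rw [sub_add_cancel]
  rw [h3, xlExpo_apply_one]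
  push_cast
  ring

theorem XLSupport.eulerD {A : Set ℝ} {h : Transseries} (hh : XLSupport A h) :
    XLSupport A (eulerD h) := by
  intro γ hγ
  rw [eulerD_apply, hh.euler_two, mul_zero, add_zero] at hγ
  rcases support_add_subset _ _ hγ with h1 | h1
  · exact hh γ (support_euler_subset 0 h h1)
  · obtain ⟨b, hb, d, hd, rfl⟩ := support_mul_subset h1
    obtain ⟨a, ha, n, rfl⟩ := hh d (support_euler_subset 1 h hd)
    rw [ellPow_one_eq_block] at hb
    obtain ⟨m, rfl, -⟩ := support_block hb
    exact ⟨0 + a, by rwa [zero_add], m + n, xlExpo_add 0 a m n⟩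

/-- Every transseries in `x` and integer powers of `ℓ` is, up to a multiple of `ℓ`, the image under
`x d/dx` of a transseries of the same kind. -/
theorem exists_eulerD_eq {A : Set ℝ} {G : Transseries} (hG : XLSupport A G) :
    ∃ H, XLSupport A H ∧ eulerD H = G - C (G.coeff (xlExpo 0 1)) * ellPow 1 1 := by
  have hF : ∀ a, ∃ F : LaurentSeries ℝ, C a * F + laurentD F =
      row a (G - C (G.coeff (xlExpo 0 1)) * ellPow 1 1) ∧
      ∀ n, F.coeff n ≠ 0 → ∃ n', G.coeff (xlExpo a n') ≠ 0 ∧ n' - 1 ≤ n := by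
    intro a
    have hrow : row a (G - C (G.coeff (xlExpo 0 1)) * ellPow 1 1) =
        row a G - if 0 = a then C (G.coeff (xlExpo 0 1)) * single 1 1 else 0 := by
      rw [sub_eq_add_neg, row_add, row_neg, row_C_mul_ellPow_one, sub_eq_add_neg]
    by_cases ha : a = 0
    · subst ha
      obtain ⟨F, hF, hs⟩ := exists_antideriv_zero (row 0 G)
      refine ⟨F, ?_, hs⟩
      rw [map_zero, zero_mul, zero_add, hF, hrow, if_pos rfl, coeff_row]
    · obtain ⟨F, hF, hs⟩ := exists_antideriv_of_ne_zero ha (row a G)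
      refine ⟨F, ?_, fun n hn => ?_⟩
      · rw [hF, hrow, if_neg (Ne.symm ha), sub_zero]
      · obtain ⟨n', h1, h2⟩ := hs n hn
        exact ⟨n', h1, by omega⟩
  choose F hF hs using hF
  let T : Set Expo := Set.range fun m : ℕ => xlExpo 0 ((m : ℤ) - 1)
  have hT : T.IsPWO := by
    have h1 : (Set.univ : Set ℕ).IsPWO := Set.isPWO_of_wellQuasiOrderedLE _
    have h2 := h1.image_of_monotone (f := fun m : ℕ => xlExpo 0 ((m : ℤ) - 1)) (by
      refine monotone_nat_of_le_succ fun m => ?_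
      refine ((xlExpo_lt_iff 0).2 ?_).le
      push_cast; omega)
    rwa [Set.image_univ] at h2
  have hmem : ∀ a n, (F a).coeff n ≠ 0 → xlExpo a n ∈ G.support + T := by
    intro a n hn
    obtain ⟨n', h1, h2⟩ := hs a n hn
    refine ⟨xlExpo a n', h1, xlExpo 0 (n - n'), ⟨(n - n' + 1).toNat, ?_⟩, ?_⟩
    · simp only
      congr 1
      omega
    · simp only
      rw [xlExpo_add, add_zero]
      congr 1
      omega
  classical
  let H : Transseries :=
    { coeff := fun γ => if γ = xlExpo (ofLex γ 0) ⌊ofLex γ 1⌋ then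
        (F (ofLex γ 0)).coeff ⌊ofLex γ 1⌋ else 0
      isPWO_support' := by
        refine (G.isPWO_support.add hT).mono fun γ hγ => ?_
        rw [Function.mem_support] at hγ
        split_ifs at hγ with h1
        · rw [h1]
          exact hmem _ _ hγ
        · exact absurd rfl hγ }
  have hHc : ∀ a n, H.coeff (xlExpo a n) = (F a).coeff n := by
    intro a n
    change (if xlExpo a n = xlExpo (ofLex (xlExpo a n) 0) ⌊ofLex (xlExpo a n) 1⌋ then
        (F (ofLex (xlExpo a n) 0)).coeff ⌊ofLex (xlExpo a n) 1⌋ else 0) = _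
    rw [xlExpo_apply_zero, xlExpo_apply_one, Int.floor_intCast, if_pos rfl]
  have hHs : XLSupport A H := by
    intro γ hγ
    have hγ' : (if γ = xlExpo (ofLex γ 0) ⌊ofLex γ 1⌋ then
        (F (ofLex γ 0)).coeff ⌊ofLex γ 1⌋ else 0) ≠ 0 := hγ
    split_ifs at hγ' with h1
    · obtain ⟨n', h2, -⟩ := hs _ _ hγ'
      obtain ⟨a, ha, m, hm⟩ := hG _ h2
      rw [h1]
      rw [xlExpo_inj] at hm
      exact ⟨a, ha, _, by rw [← hm.1]⟩
    · exact absurd rfl hγ'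
  refine ⟨H, hHs, ?_⟩
  have hHrow : ∀ a, row a H = F a := by
    intro a
    ext n
    rw [coeff_row, hHc]
  ext γ
  by_cases h1 : ∃ a n, γ = xlExpo a n
  · obtain ⟨a, n, rfl⟩ := h1
    rw [← coeff_row, ← coeff_row, hHs.row_eulerD, hHrow, hF]
  · have h2 : (eulerD H).coeff γ = 0 := by
      by_contra hne
      obtain ⟨a, -, n, hn⟩ := hHs.eulerD γ hne
      exact h1 ⟨a, n, hn⟩
    have h3 : G.coeff γ = 0 := by
      by_contra hne
      obtain ⟨a, -, n, hn⟩ := hG γ hne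
      exact h1 ⟨a, n, hn⟩
    have h4 : (ellPow 1 1).coeff γ = 0 := by
      by_contra hne
      rw [ellPow_one_eq_block] at hne
      obtain ⟨n, hn, -⟩ := support_block hne
      exact h1 ⟨0, n, hn⟩
    rw [h2, coeff_sub, h3, C_mul_eq_smul, HahnSeries.coeff_smul, h4, smul_zero, sub_zero]

/-! ### Transseries classes and sums of blocks -/

theorem laurent_finite_le (F : LaurentSeries ℝ) (c : ℝ) :
    {n : ℤ | F.coeff n ≠ 0 ∧ (n : ℝ) ≤ c}.Finite := by
  refine (Set.finite_Icc F.order ⌊c⌋).subset ?_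
  rintro n ⟨h1, h2⟩
  exact ⟨order_le_of_coeff_ne_zero h1, Int.le_floor.2 h2⟩

theorem inClass_of_support {j : ℕ} (hj : 1 ≤ j) {g : Transseries} {A : Set ℝ}
    (hA : ∀ c, {a | a ∈ A ∧ a ≤ c}.Finite)
    (h : ∀ γ ∈ g.support, (2 ≤ j ∧ γ = expo 2 (-1)) ∨ ∃ a ∈ A, ∃ n : ℤ, γ = xlExpo a n) :
    InClass j g := by
  refine ⟨fun γ hγ k hk => ?_, fun k _ p c => ?_⟩
  · rcases h γ hγ with ⟨hj2, rfl⟩ | ⟨a, -, n, rfl⟩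
    · rw [expo_apply, if_neg (by omega)]
    · exact xlExpo_apply_of_two_le a n (by omega)
  · obtain rfl | rfl | hk : k = 0 ∨ k = 1 ∨ 2 ≤ k := by omega
    · refine ((Set.finite_singleton 0).union (hA c)).subset ?_
      rintro t ⟨htc, γ, hγ, -, rfl⟩
      rcases h γ hγ with ⟨-, rfl⟩ | ⟨a, ha, n, rfl⟩
      · left; rw [Set.mem_singleton_iff, expo_apply, if_neg two_ne_zero]
      · right; rw [xlExpo_apply_zero] at htc ⊢; exact ⟨ha, htc⟩
    · refine ((Set.finite_singleton 0).union
        ((laurent_finite_le (row (p 0) g) c).image (fun n : ℤ => (n : ℝ)))).subset ?_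
      rintro t ⟨htc, γ, hγ, hp, rfl⟩
      rcases h γ hγ with ⟨-, rfl⟩ | ⟨a, ha, n, rfl⟩
      · left; rw [Set.mem_singleton_iff, expo_apply, if_neg (by omega)]
      · right
        have h0 := hp 0 one_pos
        rw [xlExpo_apply_zero] at h0
        subst h0
        rw [xlExpo_apply_one] at htc ⊢
        exact ⟨n, ⟨hγ, htc⟩, rfl⟩
    · refine (Set.toFinite {0, -1}).subset ?_
      rintro t ⟨-, γ, hγ, -, rfl⟩
      rcases h γ hγ with ⟨-, rfl⟩ | ⟨a, ha, n, rfl⟩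
      · rw [expo_apply]; split_ifs <;> simp
      · rw [xlExpo_apply_of_two_le a n hk]; simp

theorem XLSupport.inLInfty {A : Set ℝ} (hA : ∀ c, {a | a ∈ A ∧ a ≤ c}.Finite) {g : Transseries}
    (hg : XLSupport A g) : InLInfty g := by
  refine ⟨inClass_of_support le_rfl hA fun γ hγ => Or.inr (hg γ hγ), fun γ hγ => ?_⟩
  obtain ⟨a, -, n, rfl⟩ := hg γ hγ
  exact ⟨n, xlExpo_apply_one a n⟩

/-- A transseries in `x` and integer powers of `ℓ` is the formal sum of its blocks. -/
theorem XLSupport.isFormalSum_block {α : ℕ → ℝ} (hα : Function.Injective α) {g : Transseries}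
    (hg : XLSupport (Set.range α) g) : IsFormalSum (fun i => block (α i) (row (α i) g)) g := by
  have hsupp : ∀ i γ, (block (α i) (row (α i) g)).coeff γ ≠ 0 →
      γ ∈ g.support ∧ ofLex γ 0 = α i := by
    intro i γ hγ
    obtain ⟨n, rfl, hn⟩ := support_block hγ
    exact ⟨hn, xlExpo_apply_zero _ _⟩
  refine ⟨{ toFun := fun i => block (α i) (row (α i) g), isPWO_iUnion_support' := ?_,
            finite_co_support' := fun γ => ?_ }, fun i => rfl, ?_⟩
  · exact g.isPWO_support.mono (Set.iUnion_subset fun i γ hγ => (hsupp i γ hγ).1)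
  · refine Set.Subsingleton.finite fun i hi j hj => hα ?_
    rw [← (hsupp i γ hi).2, (hsupp j γ hj).2]
  · ext γ
    rw [SummableFamily.coeff_hsum]
    change ∑ᶠ i, (block (α i) (row (α i) g)).coeff γ = _
    by_cases h0 : g.coeff γ = 0
    · rw [h0]
      refine finsum_eq_zero_of_forall_eq_zero fun i => ?_
      by_contra hne
      exact (hsupp i γ hne).1 h0
    · obtain ⟨_, ⟨i, rfl⟩, n, rfl⟩ := hg γ h0
      rw [finsum_eq_single _ i]
      · rw [coeff_block_xlExpo, if_pos rfl, coeff_row]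
      · intro j hj
        rw [coeff_block_xlExpo, if_neg fun h => hj (hα h)]

theorem logDerivExpo_zero : logDerivExpo 0 = expo 0 (-1) := by simp [logDerivExpo]

theorem logDerivExpo_one : logDerivExpo 1 = expo 0 (-1) + expo 1 1 := by simp [logDerivExpo]

theorem monoDeriv_xlExpo (a : ℝ) (n : ℤ) :
    monoDeriv (xlExpo a n) = ellPow 0 (-1) * eulerD (single (xlExpo a n) 1) := by
  have hsub : (ofLex (xlExpo a n)).support ⊆ Finset.range 2 := by
    intro i hi
    rw [Finset.mem_range]
    by_contra hcon
    exact (Finsupp.mem_support_iff.1 hi) (xlExpo_apply_of_two_le a n (not_lt.1 hcon))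
  rw [monoDeriv, Finset.sum_subset hsub]
  · rw [Finset.sum_range_succ, Finset.sum_range_one, eulerD_single, xlExpo_apply_zero,
      xlExpo_apply_one, xlExpo_apply_of_two_le a n le_rfl, zero_mul, single_eq_zero, mul_zero,
      add_zero, mul_add, ellPow, ellPow, single_mul_single, single_mul_single, single_mul_single,
      logDerivExpo_zero, logDerivExpo_one]
    simp only [one_mul, mul_one]
    congr 2
    · rw [add_comm]
    · congr 1
      abel
  · intro i _ hi
    rw [Finsupp.notMem_support_iff.1 hi, single_eq_zero]

/-- Blocks are integrated term by term. -/
theorem isFormalAntideriv_block {a : ℝ} {F R : LaurentSeries ℝ} (h : C a * F + laurentD F = R) :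
    IsFormalAntideriv (block a F) (block (a - 1) R) := by
  refine ⟨⟨1, inClass_of_support le_rfl (A := {a})
    (fun c => (Set.finite_singleton a).subset fun _ h => h.1)
    fun γ hγ => Or.inr (xlSupport_block (Set.mem_singleton a) F γ hγ)⟩, ?_⟩
  obtain ⟨S, hS, hsum⟩ := exists_summableFamily_of_support_subset
    (mulOp (ellPow 0 (-1)) ∘ₗ eulerD) (S := {expo 0 (-1)} + (eulerExpo : Set Expo))
    ((Set.isPWO_singleton _).add eulerExpo_isPWO) (fun g γ hγ => by
      obtain ⟨b, hb, d, hd, rfl⟩ := support_mul_subset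
        (show γ ∈ (ellPow 0 (-1) * eulerD g).support from hγ)
      obtain ⟨u, hu, v, hv, rfl⟩ := support_eulerD_subset g hd
      have hb' : b = expo 0 (-1) := by
        by_contra hne
        exact hb (coeff_single_of_ne hne)
      refine ⟨u, hu, b + v, ⟨b, hb', v, hv, rfl⟩, ?_⟩
      simp only
      abel) (block a F)
  refine ⟨S, fun γ => ?_, ?_⟩
  · rw [hS]
    by_cases h0 : (block a F).coeff γ = 0
    · simp only [h0, map_zero, zero_mul]
    · obtain ⟨n, rfl, -⟩ := support_block h0
      simp only [monoDeriv_xlExpo]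
      rfl
  · rw [hsum]
    change ellPow 0 (-1) * eulerD (block a F) = _
    rw [eulerD_block, h, ← block_one, block_mul, one_mul]
    congr 1
    ring

/-! ### Finitely generated sets of exponents -/

theorem isDiscrete_closure {B : Finset ℝ} (hB : ∀ b ∈ B, 0 < b) :
    IsDiscrete (AddSubmonoid.closure (B : Set ℝ)) := by
  refine ⟨fun a ha => ?_, fun c => ?_⟩
  · induction ha using AddSubmonoid.closure_induction with
    | mem x hx => exact (hB x hx).le
    | zero => exact le_rfl
    | add x y _ _ hx hy => exact add_nonneg hx hy
  · refine (Set.finite_range fun g : (b : B) → Fin (⌊c / b⌋₊ + 1) =>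
      ∑ b : B, (g b : ℕ) • (b : ℝ)).subset ?_
    rintro x ⟨hx, hxc⟩
    obtain ⟨f, -, rfl⟩ := AddSubmonoid.mem_closure_finset.1 hx
    have hf : ∀ b ∈ B, f b ≤ ⌊c / b⌋₊ := by
      intro b hb
      refine Nat.le_floor ((le_div_iff₀ (hB b hb)).2 ?_)
      have h1 := Finset.single_le_sum (f := fun b => f b • b)
        (fun i hi => nsmul_nonneg (hB i hi).le (f i)) hb
      rw [← nsmul_eq_mul]
      exact h1.trans hxc
    exact ⟨fun b => ⟨f b, Nat.lt_succ_of_le (hf b b.2)⟩,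
      Finset.sum_coe_sort B fun b => f b • b⟩

theorem IsDiscrete.exists_gap {M : AddSubmonoid ℝ} (hM : IsDiscrete M) :
    ∃ μ > 0, ∀ a ∈ M, a ≠ 0 → μ ≤ a := by
  classical
  set S : Finset ℝ := insert 1 ((hM.finite 1).toFinset.erase 0) with hS
  have hne : S.Nonempty := Finset.insert_nonempty _ _
  refine ⟨S.min' hne, ?_, fun a ha h0 => ?_⟩
  · have h1 := Finset.mem_insert.1 (S.min'_mem hne)
    rw [Finset.mem_erase, Set.Finite.mem_toFinset] at h1
    rcases h1 with h1 | ⟨h1, h2, -⟩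
    · rw [h1]; exact one_pos
    · exact lt_of_le_of_ne (hM.nonneg _ h2) (Ne.symm h1)
  · rcases le_total a 1 with h1 | h1
    · refine S.min'_le a (Finset.mem_insert_of_mem (Finset.mem_erase.2 ⟨h0, ?_⟩))
      exact (hM.finite 1).mem_toFinset.2 ⟨ha, h1⟩
    · exact (S.min'_le 1 (Finset.mem_insert_self _ _)).trans h1

/-- The differences `v - c`, for `v ≥ c` in a finitely generated semigroup, lie in a finitely
generated semigroup: besides the old generators, it suffices to add the differences `w - c` for the
finitely many `w` that exceed `c` by at most the sum of the old generators. -/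
theorem exists_closure_sub_mem {B : Finset ℝ} (hB : ∀ b ∈ B, 0 < b) {c : ℝ} (hc : 0 ≤ c) :
    ∃ B' : Finset ℝ, B ⊆ B' ∧ (∀ b ∈ B', 0 < b) ∧
      ∀ v ∈ AddSubmonoid.closure (B : Set ℝ), c ≤ v →
        v - c ∈ AddSubmonoid.closure (B' : Set ℝ) := by
  classical
  set m := ∑ b ∈ B, b
  have hm : ∀ b ∈ B, b ≤ m := fun b hb =>
    Finset.single_le_sum (f := fun b => b) (fun i hi => (hB i hi).le) hb
  set W := (((isDiscrete_closure hB).finite (c + m)).toFinset.filter (c < ·)).image (· - c) with hW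
  refine ⟨B ∪ W, Finset.subset_union_left, fun b hb => ?_, fun v hv => ?_⟩
  · rcases Finset.mem_union.1 hb with h1 | h1
    · exact hB b h1
    · obtain ⟨w, hw, rfl⟩ := Finset.mem_image.1 h1
      exact sub_pos.2 (Finset.mem_filter.1 hw).2
  · induction hv using AddSubmonoid.closure_induction_left with
    | zero =>
      intro h0
      rw [le_antisymm h0 hc, sub_zero]
      exact zero_mem _
    | add_left b hb v hv ih =>
      intro hcv
      rcases le_or_gt c v with h1 | h1
      · rw [add_sub_assoc]
        refine add_mem (AddSubmonoid.subset_closure ?_) (ih h1)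
        exact_mod_cast Finset.mem_union_left W hb
      · rcases hcv.eq_or_lt with h2 | h2
        · rw [← h2, sub_self]
          exact zero_mem _
        · refine AddSubmonoid.subset_closure ?_
          refine Finset.mem_coe.2 (Finset.mem_union_right B (Finset.mem_image.2 ⟨b + v, ?_, rfl⟩))
          rw [Finset.mem_filter, Set.Finite.mem_toFinset]
          refine ⟨⟨add_mem (AddSubmonoid.subset_closure hb) hv, ?_⟩, h2⟩
          have := hm b hb
          linarith

/-- The increasing enumeration of a discrete semigroup. -/
theorem IsDiscrete.exists_enum {M : AddSubmonoid ℝ} (hM : IsDiscrete M) {d : ℝ} (hd : d ∈ M)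
    (hd0 : 0 < d) : ∃ s : ℕ → ℝ, StrictMono s ∧ Set.range s = M ∧ s 0 = 0 ∧
      Filter.Tendsto s Filter.atTop Filter.atTop := by
  have hnext : ∀ a : M, ∃ b : M, a < b ∧ ∀ b' : M, a < b' → b ≤ b' := by
    rintro ⟨a, ha⟩
    have hfin : {b | (b ∈ M ∧ b ≤ a + d) ∧ a < b}.Finite :=
      (hM.finite (a + d)).subset fun b hb => hb.1
    obtain ⟨b, ⟨⟨hb, hbd⟩, hab⟩, hmin⟩ := Set.exists_min_image _ id hfin
      ⟨a + d, ⟨add_mem ha hd, le_rfl⟩, by linarith⟩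
    refine ⟨⟨b, hb⟩, hab, ?_⟩
    rintro ⟨b', hb'⟩ hab'
    rcases le_total b' (a + d) with h1 | h1
    · exact hmin b' ⟨⟨hb', h1⟩, hab'⟩
    · exact hbd.trans h1
  choose next hlt hle using hnext
  let s : ℕ → M := fun n => next^[n] 0
  have hs : ∀ n, s (n + 1) = next (s n) := fun n => Function.iterate_succ_apply' next n 0
  have hmono : StrictMono s := strictMono_nat_of_lt_succ fun n => by rw [hs]; exact hlt _
  have htop : Filter.Tendsto (fun n => (s n : ℝ)) Filter.atTop Filter.atTop := by
    refine Filter.tendsto_atTop_atTop_of_monotone hmono.monotone fun c => ?_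
    by_contra! hcon
    refine Set.infinite_range_of_injective (f := fun n => (s n : ℝ))
      (Subtype.val_injective.comp hmono.injective) ((hM.finite c).subset ?_)
    rintro _ ⟨n, rfl⟩
    exact ⟨(s n).2, (hcon n).le⟩
  refine ⟨fun n => s n, hmono, Set.Subset.antisymm ?_ fun a ha => ?_, rfl, htop⟩
  · rintro _ ⟨n, rfl⟩
    exact (s n).2
  · have hex : ∃ n, a ≤ s n := (htop.eventually_ge_atTop a).exists
    classical
    have h1 := Nat.find_spec hex
    refine ⟨Nat.find hex, le_antisymm ?_ h1⟩
    rcases hn : Nat.find hex with _ | n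
    · exact hM.nonneg a ha
    · have h2 : ((s n : ℝ)) < a := not_le.1 (Nat.find_min hex (by omega))
      have h3 := hle (s n) ⟨a, ha⟩ h2
      simp only [hs]
      exact h3

/-! ### The expansion of a parabolic Dulac germ -/

/-- The blocks of a formal sum of blocks with distinct exponents can be read off. -/
theorem xlSupport_and_row_of_isFormalSum {α : ℕ → ℝ} (hα : Function.Injective α)
    {F : ℕ → LaurentSeries ℝ} {g : Transseries}
    (h : IsFormalSum (fun i => block (α i) (F i)) g) :
    XLSupport (Set.range α) g ∧ ∀ i, row (α i) g = F i := by
  obtain ⟨S, hS, rfl⟩ := h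
  refine ⟨fun γ hγ => ?_, fun i => ?_⟩
  · rw [mem_support, SummableFamily.coeff_hsum] at hγ
    obtain ⟨i, hi⟩ : ∃ i, (S i).coeff γ ≠ 0 := by
      by_contra! hcon
      exact hγ (finsum_eq_zero_of_forall_eq_zero hcon)
    rw [hS] at hi
    obtain ⟨n, rfl, -⟩ := support_block hi
    exact ⟨α i, ⟨i, rfl⟩, n, rfl⟩
  · ext n
    rw [coeff_row, SummableFamily.coeff_hsum, finsum_eq_single _ i]
    · rw [hS, coeff_block_xlExpo, if_pos rfl]
    · intro j hj
      rw [hS, coeff_block_xlExpo, if_neg fun h => hj (hα h)]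

/-- A Laurent polynomial as a formal Laurent series. -/
def polyLaurent (P : LaurentPolynomial ℝ) : LaurentSeries ℝ :=
  ∑ n ∈ P.coeff.support, C (P.coeff n) * single n 1

theorem coeff_polyLaurent (P : LaurentPolynomial ℝ) (n : ℤ) :
    (polyLaurent P).coeff n = P.coeff n := by
  rw [polyLaurent, HahnSeries.coeff_sum]
  simp only [C_mul_eq_smul, HahnSeries.coeff_smul, smul_eq_mul, coeff_single]
  rw [Finset.sum_eq_single n]
  · rw [if_pos rfl, mul_one]
  · intro m _ hm
    rw [if_neg hm.symm, mul_zero]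
  · intro hn
    rw [Finsupp.notMem_support_iff.1 hn, zero_mul]

theorem polyLaurent_mem_ratLaurent (P : LaurentPolynomial ℝ) : polyLaurent P ∈ ratLaurent := by
  refine sum_mem fun n _ => mul_mem (C_mem_ratLaurent _) ?_
  have h : (single n 1 : LaurentSeries ℝ) = single 1 1 ^ n := by
    rw [RatFunc.single_zpow]
  rw [h]
  exact zpow_mem single_one_mem_ratLaurent n

theorem polyBlock_eq_block (a : ℝ) (P : LaurentPolynomial ℝ) :
    polyBlock a P = block a (polyLaurent P) := by
  have h : ∀ s : Finset ℤ, block a (∑ n ∈ s, C (P.coeff n) * single n 1) =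
      ∑ n ∈ s, C (P.coeff n) * (ellPow 0 a * ellPow 1 (n : ℝ)) := by
    intro s
    induction s using Finset.cons_induction with
    | empty => rw [Finset.sum_empty, Finset.sum_empty, block_zero]
    | cons n s hn ih =>
      rw [Finset.sum_cons, Finset.sum_cons, block_add, ih]
      congr 1
      have h1 := block_mul 0 a (C (P.coeff n)) (single n 1)
      rw [block_C, ellPow_zero, mul_one, zero_add] at h1
      rw [← h1, block, embDomain_single]
      rfl
  exact (h _).symm

/-- The part of the hypotheses that the formal argument uses: the relative displacement
`f / x - 1` is nonzero, has rational blocks, no block of degree `0`, and exponents of `x` in a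
finitely generated semigroup. -/
theorem exists_displacement {f : ℝ → ℝ} {fhat : Transseries} (hf : IsParabolicDulacGerm f fhat) :
    ∃ B : Finset ℝ, (∀ b ∈ B, 0 < b) ∧
      RatIn (AddSubmonoid.closure (B : Set ℝ)) (ellPow 0 (-1) * fhat - 1) ∧
      row 0 (ellPow 0 (-1) * fhat - 1) = 0 ∧ ellPow 0 (-1) * fhat - 1 ≠ 0 := by
  obtain ⟨α, P, hD, hα0, hP0, ⟨i, hi, hPi⟩, hsum⟩ := hf
  obtain ⟨hpos, hmono, B, hB, hαB⟩ := hD.finiteType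
  obtain ⟨B', -, hB', hsub⟩ := exists_closure_sub_mem hB zero_le_one
  simp only [polyBlock_eq_block] at hsum
  obtain ⟨hsupp, hrow⟩ := xlSupport_and_row_of_isFormalSum hmono.injective hsum
  have hrow' : ∀ a, row a (ellPow 0 (-1) * fhat - 1) =
      row (a + 1) fhat - if 0 = a then 1 else 0 := by
    intro a
    rw [sub_eq_add_neg, row_add, row_neg, row_ellPow_mul, sub_neg_eq_add, ← ellPow_zero 0,
      ← block_one, row_block, sub_eq_add_neg]
  have hone : polyLaurent 1 = 1 := by
    ext n
    rw [coeff_polyLaurent, coeff_one, AddMonoidAlgebra.one_def, AddMonoidAlgebra.coeff_single,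
      Finsupp.single_apply]
    by_cases h : n = 0
    · rw [if_pos h.symm, if_pos h]
    · rw [if_neg (Ne.symm h), if_neg h]
  refine ⟨B', hB', ⟨fun γ hγ => ?_, fun a => ?_⟩, ?_, fun h => ?_⟩
  · have h0 : (0 : ℝ) ∈ AddSubmonoid.closure (B' : Set ℝ) := zero_mem _
    rw [sub_eq_add_neg] at hγ
    rcases support_add_subset _ _ hγ with h1 | h1
    · obtain ⟨b, hb, d, hd, rfl⟩ := support_mul_subset h1
      obtain ⟨_, ⟨j, rfl⟩, n, rfl⟩ := hsupp d hd
      rw [← block_one] at hb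
      obtain ⟨m, rfl, -⟩ := support_block hb
      refine ⟨α j - 1, hsub _ (hαB j) ?_, m + n, ?_⟩
      · rw [← hα0]; exact hmono.monotone (Nat.zero_le j)
      · simp only
        rw [xlExpo_add, neg_add_eq_sub]
    · rw [support_neg, ← map_one C] at h1
      exact xlSupport_C h0 1 γ h1
  · rw [hrow']
    refine sub_mem ?_ ?_
    · by_cases h1 : ∃ j, α j = a + 1
      · obtain ⟨j, hj⟩ := h1
        rw [← hj, hrow]
        exact polyLaurent_mem_ratLaurent _
      · have h2 : row (a + 1) fhat = 0 := by
          ext n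
          rw [coeff_row, coeff_zero]
          by_contra hne
          obtain ⟨_, ⟨j, rfl⟩, m, hm⟩ := hsupp _ hne
          exact h1 ⟨j, (xlExpo_inj.1 hm).1.symm⟩
        rw [h2]
        exact zero_mem _
    · split_ifs
      · exact one_mem _
      · exact zero_mem _
  · rw [hrow', if_pos rfl, zero_add, ← hα0, hrow, hP0, hone, sub_self]
  · have h1 := hrow' (α i - 1)
    have h2 : (0 : ℝ) ≠ α i - 1 := by
      have := hmono hi
      rw [hα0] at this
      linarith
    rw [h, row_zero, if_neg h2, sub_zero, sub_add_cancel, hrow] at h1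
    apply hPi
    ext n
    rw [← coeff_polyLaurent, ← h1]
    rfl

theorem leads_order (g : Transseries) : Leads g g.order (g.coeff g.order) :=
  ⟨rfl, fun _ h => coeff_eq_zero_of_lt_order h⟩

/-! ### The Abel equation -/

/-- The derivative `G` of the Fatou coordinate, with the exponents of `x` in a translate
of a finitely generated semigroup. -/
theorem exists_abel_derivative {f : Transseries} {B : Finset ℝ} (hB : ∀ b ∈ B, 0 < b)
    (hε : RatIn (AddSubmonoid.closure (B : Set ℝ)) (ellPow 0 (-1) * f - 1))
    (hε0 : row 0 (ellPow 0 (-1) * f - 1) = 0) (hne : ellPow 0 (-1) * f - 1 ≠ 0) :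
    (∃ (e : Expo) (c : ℝ), Leads (ellPow 0 (-1) * f - 1) e c ∧ 0 < e ∧ c ≠ 0) ∧
    ∃ (B' : Finset ℝ) (δ : ℝ) (G : Transseries), (∀ b ∈ B', 0 < b) ∧ 0 < δ ∧
      δ ∈ AddSubmonoid.closure (B' : Set ℝ) ∧
      formalLog (ellFactor f 0) *
        taylorOp (fun k => expCoeff (k + 1)) (formalLog (ellFactor f 0)) G = 1 ∧
      RatIn (AddSubmonoid.closure (B' : Set ℝ)) (ellPow 0 δ * G) ∧ row (-δ) G ≠ 0 := by
  have hM := isDiscrete_closure hB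
  obtain ⟨μ₁, hμ₁, hgap₁⟩ := hM.exists_gap
  set ε := ellPow 0 (-1) * f - 1 with hεdef
  have hεμ : XGe μ₁ ε := by
    have h1 := hε.xGe_sub_block_zero hgap₁
    rwa [hε0, block_zero, sub_zero] at h1
  set e := ε.order with he_def
  have hc : ε.coeff e ≠ 0 := fun h => hne (HahnSeries.coeff_order_eq_zero.1 h)
  have he : 0 < e := expo_lt_of_first (hμ₁.trans_le (hεμ e hc))
  have hL : Leads ε e (ε.coeff e) := leads_order ε
  refine ⟨⟨e, _, hL, he, hc⟩, ?_⟩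
  set τ := formalLog (ellFactor f 0) with hτdef
  have hτeq : τ = PowerSeries.heval ε (PowerSeries.log ℝ) := rfl
  have hτ : RatIn _ τ := RatIn.heval hM hε hμ₁ hεμ (hL.orderTop_pos he) (PowerSeries.log ℝ)
  have hLτ : Leads τ e (ε.coeff e) := Leads.formalLog (u := ellFactor f 0) hL he
  have hτ0 := hLτ.orderTop_pos he
  have hτμ : XGe μ₁ τ := by
    obtain ⟨q, hq⟩ := heval_eq_C_add ε (hL.orderTop_pos he) (PowerSeries.log ℝ)
    rw [hτeq, hq, PowerSeries.constantCoeff_log, map_zero, zero_add, ← add_zero μ₁]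
    exact hεμ.mul (xGe_heval (hL.orderTop_pos he) q)
  obtain ⟨δ, hδM, n, hen⟩ := hτ.support e (by rw [mem_support, hLτ.1]; exact hc)
  have hδe : ofLex e 0 = δ := by rw [hen, xlExpo_apply_zero]
  have hδ : 0 < δ := by rw [← hδe]; exact hμ₁.trans_le (hεμ e hc)
  have hq : row δ τ ≠ 0 := by
    intro h
    apply hc
    rw [← hLτ.1, hen, ← coeff_row, h, coeff_zero]
  have hτδ : ∀ γ ∈ τ.support, δ ≤ ofLex γ 0 := by
    intro γ hγ
    rw [← hδe]
    exact first_le_of_le (hLτ.le_of_ne hγ)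
  obtain ⟨B', hBB', hB', hsub⟩ := exists_closure_sub_mem hB hδ.le
  have hMM : AddSubmonoid.closure (B : Set ℝ) ≤ AddSubmonoid.closure (B' : Set ℝ) :=
    AddSubmonoid.closure_mono (by exact_mod_cast hBB')
  obtain ⟨μ₂, hμ₂, hgap₂⟩ := (isDiscrete_closure hB').exists_gap
  have hτ₁ : RatIn (AddSubmonoid.closure (B' : Set ℝ)) (ellPow 0 (-δ) * τ) := by
    refine ⟨fun γ hγ => ?_, fun a => ?_⟩
    · obtain ⟨b, hb, d, hd, rfl⟩ := support_mul_subset hγ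
      obtain ⟨a, ha, m, rfl⟩ := hτ.support d hd
      rw [← block_one] at hb
      obtain ⟨k, rfl, -⟩ := support_block hb
      have h1 := hτδ _ hd
      rw [xlExpo_apply_zero] at h1
      refine ⟨a - δ, hsub a ha h1, k + m, ?_⟩
      simp only
      rw [xlExpo_add, neg_add_eq_sub]
    · rw [row_ellPow_mul]
      exact hτ.row_mem _
  obtain ⟨G, hG, hGrat, hGrow⟩ := exists_derivative_solution (isDiscrete_closure hB') hτ0
    (lt_min hμ₁ hμ₂) (fun a ha h0 => (min_le_right _ _).trans (hgap₂ a ha h0)) (hτ.mono hMM)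
    (hτμ.mono (min_le_left _ _)) hτ₁ hq
  exact ⟨B', δ, G, hB', hδ, hMM hδM, hG, hGrat, hGrow⟩

theorem xlSupport_of_ratIn {M : AddSubmonoid ℝ} {δ : ℝ} {G : Transseries}
    (hG : RatIn M (ellPow 0 δ * G)) : XLSupport {a | a + δ ∈ M} G := by
  intro γ hγ
  have h1 : G = ellPow 0 (-δ) * (ellPow 0 δ * G) := by
    rw [← mul_assoc, ← ellPow_add, neg_add_cancel, ellPow_zero, one_mul]
  rw [h1] at hγ
  obtain ⟨b, hb, d, hd, rfl⟩ := support_mul_subset hγ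
  obtain ⟨a, ha, m, rfl⟩ := hG.support d hd
  rw [← block_one] at hb
  obtain ⟨k, rfl, -⟩ := support_block hb
  refine ⟨-δ + a, ?_, k + m, xlExpo_add _ _ _ _⟩
  change -δ + a + δ ∈ M
  rwa [neg_add_cancel_comm]

theorem XLSupport.support_add_ellPow_two {A : Set ℝ} {H : Transseries} (hH : XLSupport A H)
    (ρ : ℝ) : ∀ γ ∈ (H + C ρ * ellPow 2 (-1)).support,
      γ = expo 2 (-1) ∨ ∃ a ∈ A, ∃ n : ℤ, γ = xlExpo a n := by
  intro γ hγ
  rcases support_add_subset _ _ hγ with h1 | h1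
  · exact Or.inr (hH γ h1)
  · left
    by_contra hne
    apply h1
    rw [C_mul_eq_smul, HahnSeries.coeff_smul, ellPow, coeff_single_of_ne hne, smul_zero]

theorem eulerD_C (r : ℝ) : eulerD (C r) = 0 := by
  have h := eulerD_ellPow_zero 0
  rw [ellPow_zero, map_zero, zero_mul] at h
  rw [← mul_one (C r), map_C_mul, h, mul_zero]

end Dulac

end

open Dulac HahnSeries in
theorem mainTheorem3 (f : ℝ → ℝ) (fhat : Dulac.Transseries)
    (hf : Dulac.IsParabolicDulacGerm f fhat) :
    (∃ Ψ : Dulac.Transseries, Dulac.IsFormalFatou fhat Ψ) ∧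
    ∀ Ψ : Dulac.Transseries, Dulac.IsFormalFatou fhat Ψ →
      Dulac.InClass 2 Ψ ∧
      (∀ Ψ' : Dulac.Transseries, Dulac.IsFormalFatou fhat Ψ' →
        ∃ c : ℝ, Ψ' = Ψ + HahnSeries.C c) ∧
      ∃ (ρ : ℝ) (α : ℕ → ℝ) (F : ℕ → LaurentSeries ℝ) (R : ℕ → RatFunc ℝ),
        Dulac.InLInfty (Ψ - HahnSeries.C ρ * Dulac.ellPow 2 (-1)) ∧
        Dulac.IsFormalSum (fun i => Dulac.block (α i) (F i))
          (Ψ - HahnSeries.C ρ * Dulac.ellPow 2 (-1)) ∧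
        α 0 < 0 ∧ F 0 ≠ 0 ∧
        StrictMono α ∧ Filter.Tendsto α Filter.atTop Filter.atTop ∧
        Dulac.FinitelyGenerated (fun i => α i - α 0) ∧
        (∀ i, Dulac.IsFormalAntideriv (Dulac.block (α i) (F i))
          (Dulac.block (α i - 1) (R i : LaurentSeries ℝ))) ∧
        (∀ γ ∈ Ψ.support, (∃ k, 2 ≤ k ∧ ofLex γ k ≠ 0) → γ = Dulac.expo 2 (-1)) := by
  obtain ⟨B, hB, hε, hε0, hne⟩ := exists_displacement hf
  obtain ⟨⟨e, c, hL, he, hc⟩, B', δ, G, hB', hδ, hδM, hG, hGrat, hGrow⟩ :=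
    exists_abel_derivative hB hε hε0 hne
  set M := AddSubmonoid.closure (B' : Set ℝ) with hMdef
  have hM : Dulac.IsDiscrete M := isDiscrete_closure hB'
  set A : Set ℝ := {a | a + δ ∈ M} with hA
  have hAfin : ∀ c, {a | a ∈ A ∧ a ≤ c}.Finite := by
    intro c
    refine ((hM.finite (c + δ)).image (· - δ)).subset ?_
    rintro a ⟨ha, hac⟩
    exact ⟨a + δ, ⟨ha, by linarith⟩, add_sub_cancel_right a δ⟩
  have h0A : (0 : ℝ) ∈ A := by
    change 0 + δ ∈ M
    rwa [zero_add]
  have hGA : XLSupport A G := xlSupport_of_ratIn hGrat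
  have hGrows : ∀ a, row a G ∈ ratLaurent := by
    intro a
    have h1 := hGrat.row_mem (a + δ)
    rwa [row_ellPow_mul, add_sub_cancel_right] at h1
  obtain ⟨H, hHA, hH⟩ := exists_eulerD_eq hGA
  set ρ := -G.coeff (xlExpo 0 1) with hρ
  -- the residue of `G` is produced by the iterated logarithm
  have hDΨ : eulerD (H + C ρ * ellPow 2 (-1)) = G := by
    rw [map_add, map_C_mul, hH, eulerD_ellPow_two, hρ, map_neg]
    ring
  have hFatou : IsFormalFatou fhat (H + C ρ * ellPow 2 (-1)) := by
    refine ⟨⟨2, inClass_of_support one_le_two hAfin fun γ hγ => ?_⟩, ?_⟩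
    · exact (hHA.support_add_ellPow_two ρ γ hγ).imp_left fun h => ⟨le_rfl, h⟩
    · have h1 := isComp_taylorOp hL he (H + C ρ * ellPow 2 (-1)) fun γ hγ =>
        (hHA.support_add_ellPow_two ρ γ hγ).imp_right fun ⟨a, _, n, h⟩ => ⟨a, n, h⟩
      rwa [taylorOp_shift expCoeff (ellFactor_orderTop_pos hL he 0).2.1, hDΨ, hG, expCoeff_zero,
        map_one, one_mul] at h1
  have hunique : ∀ Ψ Ψ' : Transseries, IsFormalFatou fhat Ψ → IsFormalFatou fhat Ψ' →
      ∃ k : ℝ, Ψ' = Ψ + C k := by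
    intro Ψ Ψ' h h'
    have h1 := h'.2.sub h.2
    rw [add_sub_add_right_eq_sub] at h1
    exact ⟨_, sub_eq_iff_eq_add'.1 (eq_C_of_isComp_self hL he hc h1)⟩
  refine ⟨⟨_, hFatou⟩, fun Ψ hΨ => ?_⟩
  obtain ⟨k, hk⟩ := hunique _ Ψ hFatou hΨ
  set H' := H + C k with hH'
  have hH'A : XLSupport A H' := hHA.add (xlSupport_C h0A k)
  have hΨeq : Ψ = H' + C ρ * ellPow 2 (-1) := by
    rw [hk, hH']
    ring
  have hsub : Ψ - C ρ * ellPow 2 (-1) = H' := by rw [hΨeq, add_sub_cancel_right]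
  have hsupp := hH'A.support_add_ellPow_two ρ
  rw [← hΨeq] at hsupp
  have hDH' : ∀ a, row a (eulerD H') =
      row a G - if 0 = a then C (G.coeff (xlExpo 0 1)) * single 1 1 else 0 := by
    intro a
    rw [hH', map_add, eulerD_C, add_zero, hH, sub_eq_add_neg, row_add, row_neg,
      row_C_mul_ellPow_one, sub_eq_add_neg]
  have hrat : ∀ a, ∃ R : RatFunc ℝ, (R : LaurentSeries ℝ) = row a (eulerD H') := by
    intro a
    rw [← mem_ratLaurent, hDH']
    refine sub_mem (hGrows a) ?_
    split_ifs
    · exact mul_mem (C_mem_ratLaurent _) single_one_mem_ratLaurent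
    · exact zero_mem _
  choose R hR using hrat
  obtain ⟨s, hs, hsM, hs0, htends⟩ := hM.exists_enum hδM hδ
  have hα : StrictMono fun i => s i - δ := fun i j hij => sub_lt_sub_right (hs hij) δ
  have hrange : Set.range (fun i => s i - δ) = A := by
    ext a
    rw [hA, Set.mem_range]
    change _ ↔ a + δ ∈ (M : Set ℝ)
    rw [← hsM, Set.mem_range]
    exact exists_congr fun i => sub_eq_iff_eq_add
  refine ⟨?_, fun Ψ' hΨ' => hunique Ψ Ψ' hΨ hΨ', ρ, fun i => s i - δ,
    fun i => row (s i - δ) H', fun i => R (s i - δ), ?_, ?_, ?_, fun h => ?_, hα, ?_, ?_,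
    fun i => ?_, fun γ hγ => ?_⟩
  · exact inClass_of_support one_le_two hAfin fun γ hγ => (hsupp γ hγ).imp_left fun h => ⟨le_rfl, h⟩
  · rw [hsub]
    exact hH'A.inLInfty hAfin
  · rw [hsub]
    exact XLSupport.isFormalSum_block hα.injective (by rwa [hrange])
  · simp only [hs0]
    linarith
  · -- a vanishing first block would have a vanishing derivative
    change row (s 0 - δ) H' = 0 at h
    rw [hs0, zero_sub] at h
    have h1 := hH'A.row_eulerD (-δ)
    have h2 : laurentD 0 = 0 := by
      rw [← map_zero C, laurentD_C, map_zero]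
    rw [h, mul_zero, h2, zero_add, hDH', if_neg (by linarith), sub_zero] at h1
    exact hGrow h1
  · exact Filter.tendsto_atTop_add_const_right _ (-δ) htends
  · refine ⟨B', hB', fun i => ?_⟩
    simp only [hs0, zero_sub, sub_neg_eq_add, sub_add_cancel]
    change s i ∈ (M : Set ℝ)
    rw [← hsM]
    exact ⟨i, rfl⟩
  · refine isFormalAntideriv_block ?_
    rw [hR, hH'A.row_eulerD]
  · rintro ⟨j, hj, hγj⟩
    rcases hsupp γ hγ with h1 | ⟨a, -, n, rfl⟩
    · exact h1
    · exact absurd (xlExpo_apply_of_two_le a n hj) hγj
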